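/- Let $\mathcal E$ be an elementary topos (finite limits, exponentials, a subobject classifier $\Omega$) with countable colimits. Let a finite diagram in $\mathcal E$ be given by objects $A_1,\dots,A_n$ and morphisms $f_i : A_{s(i)} \to A_{t(i)}$ for $i=1,\dots,m$, where $s,t$ are functions from $\{1,\dots,m\}$ to $\{1,\dots,n\}$ ($n,m\ge 0$). We use the internal (Mitchell–Bénabou) language of $\mathcal E$, with countable disjunctions: $PA$ is the type $\Omega^A$, and $[\![\Gamma.\,t]\!]$, $[\![\Gamma.\,p]\!]$ are the interpretations of a term $t$ (a morphism) and of a formula $p$ (a subobject) in the context $\Gamma$. Empty disjunctions are $\bot$, empty unions are $\varnothing$, and the empty product is the terminal object. *Coproducts.* For a list of objects $X_1,\dots,X_k$ let $(\coprod_j X_j)(z)$ be the formula, with free variable $z:\prod_j PX_j$, $$\bigvee_{j}\ \exists x : X_j,\ z = \langle \varnothing,\dots,\{x\},\dots,\varnothing\rangle \quad(\{x\}\text{ in place } j),$$ and let $\coprod_j X_j \rightarrowtail \prod_j \Omega^{X_j}$ also denote its interpretation. *Terms of the diagram.* In the context $Z_1:P(\operatorname{dom} f_1),\dots,Z_m:P(\operatorname{dom}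 f_m)$ let $t_0$, $t_1$ be the terms of type $B:=\prod_j PA_j$ whose $j$-th components are $\bigcup_{s(i)=j} Z_i$ and $\bigcup_{t(i)=j} f_i(Z_i)$ respectively, where $f(S)=\{b\mid \exists a,\ a\in S\wedge b=fa\}$. We also regard them as terms in one variable $a$ of type $\prod_i P(\operatorname{dom}f_i)$. Let $$R_{t_0,t_1}=\Big\{z : B\times B\ \Big|\ \exists b_1,b_2,\ z=\langle b_1,b_2\rangle\wedge\Big(b_1=b_2\vee\bigvee_{k\ge1}\bigvee_{\alpha\in\{0,1\}^k}\exists a_1,\dots,a_k,\ b_1=t_{\alpha_1}[a_1]\wedge\bigwedge_{i<k}t_{1-\alpha_i}[a_i]=t_{\alpha_{i+1}}[a_{i+1}]\wedge t_{1-\alpha_k}[a_k]=b_2\Big)\Big\},$$ $$[b]_{t_0,t_1}=\{b':B\mid\langle b,b'\rangle\in R_{t_0,t_1}\}.$$ Let $\operatorname{Coeq}(t_0,t_1)\rightarrowtail\Omega^{\prod_j\Omega^{A_j}}$ be the subobject $[\![z:PB.\ \exists b:B,\ (\coprod_jA_j)(b)\wedge z=[b]_{t_0,t_1}]\!]$ of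 classes of elements of $\coprod_j A_j$. It is contained in the subobject $[\![z:PB.\ \exists b:B,\ z=[b]_{t_0,t_1}]\!]$ of all classes. *Claim.* The morphisms $[\![t_0]\!]$, $[\![t_1]\!]$ and $[\![b:B.\,[b]_{t_0,t_1}]\!]$ restrict to morphisms $g_0$, $g_1$ and $q$ giving a diagram $$\begin{array}{ccccc}\prod_{i}\Omega^{\operatorname{dom}f_i}&\underset{[\![t_1]\!]}{\overset{[\![t_0]\!]}{\rightrightarrows}}&\prod_{j}\Omega^{A_j}&\xrightarrow{[\![b.\,[b]_{t_0,t_1}]\!]}&\Omega^{\prod_j\Omega^{A_j}}\\ \uparrow&&\uparrow&&\uparrow\\ \coprod_{i}\operatorname{dom}f_i&\underset{g_1}{\overset{g_0}{\rightrightarrows}}&\coprod_{j}A_j&\xrightarrow{\ q\ }&\operatorname{Coeq}(t_0,t_1)\end{array}$$ whose vertical arrows are the inclusions of the subobjects and in which the square of $g_0$, the square of $g_1$ and the square of $q$ commute. Moreover: * the morphisms $[\![x.\,\langle\varnothing,\dots,\{x\},\dots,\varnothing\rangle]\!]$ factor through morphisms $\iota'_i:\operatorname{dom}f_i\to\coprod_i\operatorname{dom}f_i$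 and $\iota_j:A_j\to\coprod_jA_j$, which are coproduct injections making these two objects coproducts in $\mathcal E$; * $g_0\iota'_i=\iota_{s(i)}$ and $g_1\iota'_i=\iota_{t(i)}f_i$ for all $i$; * $q$ is a coequaliser of $g_0$ and $g_1$ in $\mathcal E$, so that $\operatorname{Coeq}(t_0,t_1)$ with the morphisms $q\iota_j:A_j\to\operatorname{Coeq}(t_0,t_1)$ is a colimit of the given diagram. -/

import Mathlib

open CategoryTheory Limits MonoidalCategory CartesianMonoidalCategory

universe v u

noncomputable section

namespace InternalLogic

/-! ## Subobjects and power objects in a topos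

An elementary topos is a category with finite limits (with chosen finite products), exponentials
and a subobject classifier. -/

section Topos

variable {C : Type u} [Category.{v} C] [CartesianMonoidalCategory C] [HasFiniteLimits C]
  [MonoidalClosed C] [HasSubobjectClassifier C] [HasCountableColimits C]

/-- The power object `P A = Ω ^ A`. -/
abbrev Pow (A : C) : C := (ihom A).obj (HasSubobjectClassifier.Ω C)

/-- The characteristic morphism `X ⟶ Ω` of a subobject of `X`. -/
def chi {X : C} (p : Subobject X) : X ⟶ HasSubobjectClassifier.Ω C :=
  HasSubobjectClassifier.χ p.arrow

/-- The membership subobject `∈_A ↣ A × Ω ^ A`: the one classified by evaluation. -/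
def memSub (A : C) : Subobject (A ⊗ Pow A) :=
  (Subobject.pullback ((ihom.ev A).app (HasSubobjectClassifier.Ω C))).obj
    (Subobject.mk (HasSubobjectClassifier.truth C))

/-- The name `Y ⟶ Ω ^ A` of a subobject of `Y × A`: the transpose of its characteristic
morphism. -/
def nameOf {Y A : C} (p : Subobject (Y ⊗ A)) : Y ⟶ Pow A :=
  MonoidalClosed.curry (lift (snd A Y) (fst A Y) ≫ chi p)

/-- The image of a morphism: the equaliser of its cokernel pair. -/
def imSub {X Y : C} (f : X ⟶ Y) : Subobject Y :=
  equalizerSubobject (pushout.inl f f) (pushout.inr f f)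

/-- The least subobject: the image of the morphism from the initial object (which is
itself a monomorphism in a topos). -/
def botSub (X : C) : Subobject X := imSub (initial.to X)

/-- The union of two subobjects: the image of the morphism out of the coproduct. -/
def orSub {X : C} (p q : Subobject X) : Subobject X := imSub (coprod.desc p.arrow q.arrow)

/-- The union of a sequence of subobjects. -/
def iSupSub {X : C} (p : ℕ → Subobject X) : Subobject X :=
  imSub (Sigma.desc fun n => (p n).arrow)

/-- Heyting implication of subobjects: the largest `r` with `r ⊓ p ≤ q`. -/
def impSub {X : C} (p q : Subobject X) : Subobject X :=
  equalizerSubobject (chi (p ⊓ q)) (chi p)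

/-- The left adjoint to pulling back along the projection `Y × A ⟶ Y`. -/
def exSub {Y A : C} (p : Subobject (Y ⊗ A)) : Subobject Y := imSub (p.arrow ≫ fst Y A)

/-- The right adjoint to pulling back along the projection `Y × A ⟶ Y`. -/
def allSub {Y A : C} (p : Subobject (Y ⊗ A)) : Subobject Y :=
  equalizerSubobject (nameOf p) (nameOf (⊤ : Subobject (Y ⊗ A)))

end Topos

/-! ## The language

The types are the objects of the category, product and power types being identified with the
chosen products and power objects.  Terms and formulas are taken up to renaming of bound
variables by using well-typed de Bruijn indices. -/

/-- Contexts: finite sequences of types, extended on the right. -/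
inductive Ctx (C : Type u) : Type u
  | nil : Ctx C
  | snoc : Ctx C → C → Ctx C

/-- `Var Γ A`: the variables of type `A` in the context `Γ`. -/
inductive Var {C : Type u} : Ctx C → C → Type u
  | zero {Γ : Ctx C} {A : C} : Var (Γ.snoc A) A
  | succ {Γ : Ctx C} {A B : C} : Var Γ A → Var (Γ.snoc B) A

section Language

variable {C : Type u} [Category.{v} C] [CartesianMonoidalCategory C]
  [MonoidalClosed C] [HasSubobjectClassifier C]

variable (C) in
mutual

/-- `Tm C Γ A`: the terms of type `A` with free variables in `Γ`. -/
inductive Tm : Ctx C → C → Type (max u v)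
  | var {Γ : Ctx C} {A : C} : Var Γ A → Tm Γ A
  | star {Γ : Ctx C} : Tm Γ (𝟙_ C)
  | pair {Γ : Ctx C} {A B : C} : Tm Γ A → Tm Γ B → Tm Γ (A ⊗ B)
  | fst {Γ : Ctx C} {A B : C} : Tm Γ (A ⊗ B) → Tm Γ A
  | snd {Γ : Ctx C} {A B : C} : Tm Γ (A ⊗ B) → Tm Γ B
  | app {Γ : Ctx C} {A B : C} : (A ⟶ B) → Tm Γ A → Tm Γ B
  | setOf {Γ : Ctx C} {A : C} : Fm (Γ.snoc A) → Tm Γ (Pow A)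

/-- `Fm C Γ`: the formulas with free variables in `Γ`. -/
inductive Fm : Ctx C → Type (max u v)
  | top {Γ : Ctx C} : Fm Γ
  | bot {Γ : Ctx C} : Fm Γ
  | rel {Γ : Ctx C} {A : C} : Subobject A → Tm Γ A → Fm Γ
  | eq {Γ : Ctx C} {A : C} : Tm Γ A → Tm Γ A → Fm Γ
  | mem {Γ : Ctx C} {A : C} : Tm Γ A → Tm Γ (Pow A) → Fm Γ
  | and {Γ : Ctx C} : Fm Γ → Fm Γ → Fm Γ
  | or {Γ : Ctx C} : Fm Γ → Fm Γ → Fm Γ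
  | imp {Γ : Ctx C} : Fm Γ → Fm Γ → Fm Γ
  | iSup {Γ : Ctx C} : (ℕ → Fm Γ) → Fm Γ
  | all {Γ : Ctx C} {A : C} : Fm (Γ.snoc A) → Fm Γ
  | ex {Γ : Ctx C} {A : C} : Fm (Γ.snoc A) → Fm Γ

end

/-- Renamings of variables. -/
abbrev Ren (Γ Δ : Ctx C) : Type u := ∀ A : C, Var Γ A → Var Δ A

/-- A renaming passed under a binder. -/
def Ren.lift {Γ Δ : Ctx C} (ρ : Ren Γ Δ) (B : C) : Ren (Γ.snoc B) (Δ.snoc B)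
  | _, .zero => .zero
  | _, .succ x => .succ (ρ _ x)

mutual

/-- Renaming of the free variables of a term. -/
def Tm.ren : ∀ {Γ : Ctx C} {A : C}, Tm C Γ A → ∀ {Δ : Ctx C}, Ren Γ Δ → Tm C Δ A
  | _, _, .var x, _, ρ => .var (ρ _ x)
  | _, _, .star, _, _ => .star
  | _, _, .pair t s, _, ρ => .pair (t.ren ρ) (s.ren ρ)
  | _, _, .fst t, _, ρ => .fst (t.ren ρ)
  | _, _, .snd t, _, ρ => .snd (t.ren ρ)
  | _, _, .app f t, _, ρ => .app f (t.ren ρ)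
  | _, _, .setOf p, _, ρ => .setOf (p.ren (ρ.lift _))

/-- Renaming of the free variables of a formula. -/
def Fm.ren : ∀ {Γ : Ctx C}, Fm C Γ → ∀ {Δ : Ctx C}, Ren Γ Δ → Fm C Δ
  | _, .top, _, _ => .top
  | _, .bot, _, _ => .bot
  | _, .rel R t, _, ρ => .rel R (t.ren ρ)
  | _, .eq t s, _, ρ => .eq (t.ren ρ) (s.ren ρ)
  | _, .mem t T, _, ρ => .mem (t.ren ρ) (T.ren ρ)
  | _, .and p q, _, ρ => .and (p.ren ρ) (q.ren ρ)
  | _, .or p q, _, ρ => .or (p.ren ρ) (q.ren ρ)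
  | _, .imp p q, _, ρ => .imp (p.ren ρ) (q.ren ρ)
  | _, .iSup p, _, ρ => .iSup fun n => (p n).ren ρ
  | _, .all p, _, ρ => .all (p.ren (ρ.lift _))
  | _, .ex p, _, ρ => .ex (p.ren (ρ.lift _))

end

/-- A term regarded in a context with one more variable. -/
def Tm.wk {Γ : Ctx C} {A : C} (t : Tm C Γ A) (B : C) : Tm C (Γ.snoc B) A :=
  t.ren fun _ x => .succ x

/-- Simultaneous substitutions: a term in context `Δ` for each variable of `Γ`. -/
abbrev Sub (Γ Δ : Ctx C) : Type (max u v) := ∀ A : C, Var Γ A → Tm C Δ A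

/-- A substitution passed under a binder. -/
def Sub.lift {Γ Δ : Ctx C} (σ : Sub Γ Δ) (B : C) : Sub (Γ.snoc B) (Δ.snoc B)
  | _, .zero => .var .zero
  | _, .succ x => (σ _ x).wk B

mutual

/-- Simultaneous (capture-avoiding) substitution in a term. -/
def Tm.subst : ∀ {Γ : Ctx C} {A : C}, Tm C Γ A → ∀ {Δ : Ctx C}, Sub Γ Δ → Tm C Δ A
  | _, _, .var x, _, σ => σ _ x
  | _, _, .star, _, _ => .star
  | _, _, .pair t s, _, σ => .pair (t.subst σ) (s.subst σ)
  | _, _, .fst t, _, σ => .fst (t.subst σ)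
  | _, _, .snd t, _, σ => .snd (t.subst σ)
  | _, _, .app f t, _, σ => .app f (t.subst σ)
  | _, _, .setOf p, _, σ => .setOf (p.subst (σ.lift _))

/-- Simultaneous (capture-avoiding) substitution in a formula. -/
def Fm.subst : ∀ {Γ : Ctx C}, Fm C Γ → ∀ {Δ : Ctx C}, Sub Γ Δ → Fm C Δ
  | _, .top, _, _ => .top
  | _, .bot, _, _ => .bot
  | _, .rel R t, _, σ => .rel R (t.subst σ)
  | _, .eq t s, _, σ => .eq (t.subst σ) (s.subst σ)
  | _, .mem t T, _, σ => .mem (t.subst σ) (T.subst σ)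
  | _, .and p q, _, σ => .and (p.subst σ) (q.subst σ)
  | _, .or p q, _, σ => .or (p.subst σ) (q.subst σ)
  | _, .imp p q, _, σ => .imp (p.subst σ) (q.subst σ)
  | _, .iSup p, _, σ => .iSup fun n => (p n).subst σ
  | _, .all p, _, σ => .all (p.subst (σ.lift _))
  | _, .ex p, _, σ => .ex (p.subst (σ.lift _))

end

/-! ## Contexts as objects -/

/-- The product `(⋯(A₁ × A₂) × ⋯) × Aₙ` of the types of a context; it is the terminal object for
the empty context and `A` for a context with a single variable of type `A`. -/
def Ctx.obj : Ctx C → C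
  | .nil => 𝟙_ C
  | .snoc .nil A => A
  | .snoc (.snoc Γ B) A => Ctx.obj (.snoc Γ B) ⊗ A

/-- The object of `Γ, A` is a product of the object of `Γ` and `A`. -/
def Ctx.snocIso : ∀ (Γ : Ctx C) (A : C), (Γ.snoc A).obj ≅ Γ.obj ⊗ A
  | .nil, A => (λ_ A).symm
  | .snoc _ _, _ => Iso.refl _

/-- The context consisting of variables of types `X 0, …, X (n - 1)`, in this order. -/
def Ctx.ofFn : ∀ {n : ℕ}, (Fin n → C) → Ctx C
  | 0, _ => .nil
  | _ + 1, X => .snoc (Ctx.ofFn fun i => X i.castSucc) (X (Fin.last _))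

/-- The `j`-th variable of the context `X 0, …, X (n - 1)`. -/
def Var.ofFn : ∀ {n : ℕ} (X : Fin n → C) (j : Fin n), Var (Ctx.ofFn X) (X j)
  | 0, _, j => j.elim0
  | _ + 1, X, j =>
    Fin.lastCases (motive := fun j => Var (Ctx.ofFn X) (X j)) .zero
      (fun i => .succ (Var.ofFn (fun i => X i.castSucc) i)) j

/-- The iterated product `(⋯(X 0 × X 1) × ⋯) × X (n - 1)`. -/
abbrev prodObj {n : ℕ} (X : Fin n → C) : C := (Ctx.ofFn X).obj

/-- The tuple `⟨⋯⟨t 0, t 1⟩, ⋯, t (n - 1)⟩` of the terms of a substitution. -/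
def Sub.tuple : ∀ {Γ Δ : Ctx C}, Sub Γ Δ → Tm C Δ Γ.obj
  | .nil, _, _ => .star
  | .snoc .nil A, _, σ => σ A .zero
  | .snoc (.snoc _ _) A, _, σ => .pair (Sub.tuple fun X x => σ X (.succ x)) (σ A .zero)

/-- The component, at a variable of `Γ`, of a term whose type is the product of the types
of `Γ`. -/
def Var.proj : ∀ {Γ : Ctx C} {A : C}, Var Γ A → ∀ {Δ : Ctx C}, Tm C Δ Γ.obj → Tm C Δ A
  | .snoc .nil _, _, .zero, _, w => w
  | .snoc (.snoc _ _) _, _, .zero, _, w => .snd w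
  | .snoc (.snoc _ _) _, _, .succ x, _, w => x.proj (.fst w)

/-- The substitution with given terms for the variables of the context
`X 0, …, X (n - 1)`. -/
def Sub.ofFn : ∀ {n : ℕ} {X : Fin n → C} {Δ : Ctx C}, (∀ j, Tm C Δ (X j)) →
    Sub (Ctx.ofFn X) Δ
  | 0, _, _, _ => nofun
  | _ + 1, _, _, t => fun
    | _, .zero => t (Fin.last _)
    | _, .succ x => Sub.ofFn (fun i => t i.castSucc) _ x

/-- The tuple `⟨⋯⟨t 0, t 1⟩, ⋯, t (n - 1)⟩`. -/
def tuple {n : ℕ} {X : Fin n → C} {Δ : Ctx C} (t : ∀ j, Tm C Δ (X j)) : Tm C Δ (prodObj X) :=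
  (Sub.ofFn t).tuple

/-- A term in several variables as a term in one variable ranging over the product of
their types. -/
def Tm.unpack {Γ : Ctx C} {B : C} (t : Tm C Γ B) : Tm C (.snoc .nil Γ.obj) B :=
  t.subst fun _ x => x.proj (.var .zero)

/-- The substitution `t[a := s]` for the only free variable `a` of `t`. -/
def Tm.inst {A B : C} {Δ : Ctx C} (t : Tm C (.snoc .nil A) B) (s : Tm C Δ A) : Tm C Δ B :=
  t.subst fun
    | _, .zero => s

/-! ## Some terms and formulas -/

section Terms

variable {Γ : Ctx C}

/-- Finite disjunctions; the empty one is `⊥`. -/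
def disj : List (Fm C Γ) → Fm C Γ
  | [] => .bot
  | [p] => p
  | p :: q :: l => .or p (disj (q :: l))

/-- Finite conjunctions; the empty one is `⊤`. -/
def conj : List (Fm C Γ) → Fm C Γ
  | [] => .top
  | [p] => p
  | p :: q :: l => .and p (conj (q :: l))

/-- `{t} = {a : A | a = t}`. -/
def sing {A : C} (t : Tm C Γ A) : Tm C Γ (Pow A) := .setOf (.eq (.var .zero) (t.wk A))

/-- `∅ = {a : A | ⊥}`. -/
def empty (A : C) : Tm C Γ (Pow A) := .setOf .bot

/-- `S ∪ T = {a : A | a ∈ S ∨ a ∈ T}`. -/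
def union {A : C} (S T : Tm C Γ (Pow A)) : Tm C Γ (Pow A) :=
  .setOf (.or (.mem (.var .zero) (S.wk A)) (.mem (.var .zero) (T.wk A)))

/-- Finite unions; the empty one is `∅`. -/
def unions {A : C} : List (Tm C Γ (Pow A)) → Tm C Γ (Pow A)
  | [] => empty A
  | [S] => S
  | S :: T :: l => union S (unions (T :: l))

/-- `f(S) = {b : B | ∃ a : A, a ∈ S ∧ b = f a}`. -/
def image {A B : C} (f : A ⟶ B) (S : Tm C Γ (Pow A)) : Tm C Γ (Pow B) :=
  .setOf (.ex (A := A) (.and (.mem (.var .zero) ((S.wk B).wk A))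
    (.eq (.var (.succ .zero)) (.app f (.var .zero)))))

/-- `⟨∅, …, {a}, …, ∅⟩ : P A₁ × ⋯ × P Aₙ`, with `{a}` in place `j`. -/
def inj {n : ℕ} (A : Fin n → C) (j : Fin n) (a : Tm C Γ (A j)) :
    Tm C Γ (prodObj fun k => Pow (A k)) :=
  tuple (X := fun k => Pow (A k)) fun k => if h : k = j then h ▸ sing a else empty (A k)

/-- `(A₁ ∐ ⋯ ∐ Aₙ)(z)`: the disjunction over `j` of the formulas
`∃ a : A j, z = ⟨∅, …, {a}, …, ∅⟩`. -/
def coprodFm {n : ℕ} (A : Fin n → C) (z : Tm C Γ (prodObj fun k => Pow (A k))) : Fm C Γ :=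
  disj ((List.finRange n).map fun j =>
    .ex (A := A j) (.eq (z.wk (A j)) (inj A j (.var .zero))))

/-- The context `Γ, a₁ : A, …, aₙ : A`. -/
def Ctx.snocN (Γ : Ctx C) (A : C) : ℕ → Ctx C
  | 0 => Γ
  | n + 1 => (Ctx.snocN Γ A n).snoc A

/-- `∃ a₁, …, aₙ : A, p`. -/
def exN {A : C} : ∀ n : ℕ, Fm C (Γ.snocN A n) → Fm C Γ
  | 0, p => p
  | n + 1, p => exN n (.ex p)

/-- A term in context `Γ` regarded in context `Γ, a₁ : A, …, aₙ : A`. -/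
def Tm.wkN {A B : C} (t : Tm C Γ B) : ∀ n : ℕ, Tm C (Γ.snocN A n) B
  | 0 => t
  | n + 1 => (t.wkN n).wk A

/-- The variables `a₁, …, aₙ` in the context `Γ, a₁ : A, …, aₙ : A`. -/
def Var.snocN {A : C} : ∀ n : ℕ, Fin n → Var (Γ.snocN A n) A
  | 0 => fun i => i.elim0
  | n + 1 => Fin.lastCases .zero fun i => .succ (Var.snocN n i)

/-- For `n = k + 1` variables `a₁, …, aₙ` and `α ∈ {0, 1}ⁿ`, the formula
`∃ a₁, …, aₙ, b₁ = t_{α₁}[a₁] ∧ t_{α₁ + 1}[a₁] = t_{α₂}[a₂] ∧ ⋯ ∧ t_{αₙ + 1}[aₙ] = b₂`,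
where `false` and `true` stand for `0` and `1`. -/
def zigzag {A B : C} (t : Bool → Tm C (.snoc .nil A) B) (b₁ b₂ : Tm C Γ B) (k : ℕ)
    (α : Fin (k + 1) → Bool) : Fm C Γ :=
  let a (i : Fin (k + 1)) : Tm C (Γ.snocN A (k + 1)) A := .var (Var.snocN (k + 1) i)
  exN (k + 1) (conj (
    [.eq (b₁.wkN (k + 1)) ((t (α 0)).inst (a 0))] ++
    List.ofFn (fun i : Fin k =>
      Fm.eq ((t (!α i.castSucc)).inst (a i.castSucc)) ((t (α i.succ)).inst (a i.succ))) ++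
    [.eq ((t (!α (Fin.last k))).inst (a (Fin.last k))) (b₂.wkN (k + 1))]))

/-- The term `R_{t₀,t₁} : P (B × B)` of the equivalence relation generated by the pairs
`(t₀[a], t₁[a])`:
`{z | ∃ b₁ b₂, z = ⟨b₁, b₂⟩ ∧ (b₁ = b₂ ∨ ⋁_{n ≥ 1} ⋁_{α ∈ {0, 1}ⁿ} zigzag)}`. -/
def relTm {A B : C} (t₀ t₁ : Tm C (.snoc .nil A) B) : Tm C Γ (Pow (B ⊗ B)) :=
  let b₁ : Tm C (((Γ.snoc (B ⊗ B)).snoc B).snoc B) B := .var (.succ .zero)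
  let b₂ : Tm C (((Γ.snoc (B ⊗ B)).snoc B).snoc B) B := .var .zero
  .setOf (.ex (A := B) (.ex (A := B)
    (.and (.eq (.var (.succ (.succ .zero))) (.pair b₁ b₂))
      (.or (.eq b₁ b₂)
        (.iSup fun k => disj ((Finset.univ : Finset (Fin (k + 1) → Bool)).toList.map
          (zigzag (fun c => cond c t₁ t₀) b₁ b₂ k)))))))

/-- `[b]_{t₀,t₁} = {b' : B | ⟨b, b'⟩ ∈ R_{t₀,t₁}}`. -/
def classTm {A B : C} (t₀ t₁ : Tm C (.snoc .nil A) B) (b : Tm C Γ B) : Tm C Γ (Pow B) :=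
  .setOf (.mem (.pair (b.wk B) (.var .zero)) (relTm t₀ t₁))

/-- `Coeq(t₀, t₁)(z)`: the formula `∃ b : B, z = [b]_{t₀,t₁}`. -/
def coeqFm {A B : C} (t₀ t₁ : Tm C (.snoc .nil A) B) (z : Tm C Γ (Pow B)) : Fm C Γ :=
  .ex (A := B) (.eq (z.wk B) (classTm t₀ t₁ (.var .zero)))

/-- `Coeq(t₀, t₁)(z)` with `b` restricted to a subobject `S` of `B` given by a formula:
`∃ b : B, S(b) ∧ z = [b]_{t₀,t₁}`. -/
def coeqOnFm {A B : C} (S : Fm C (.snoc .nil B)) (t₀ t₁ : Tm C (.snoc .nil A) B)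
    (z : Tm C Γ (Pow B)) : Fm C Γ :=
  .ex (A := B) (.and
    (S.subst fun
      | _, .zero => .var .zero)
    (.eq (z.wk B) (classTm t₀ t₁ (.var .zero))))

end Terms

/-! ## The terms of a finite diagram

A finite diagram consists of objects `A 0, …, A (n - 1)` and of morphisms
`f i : A (s i) ⟶ A (t i)` for `i = 0, …, m - 1`. -/

section Diagram

variable {n m : ℕ} (A : Fin n → C) {s t : Fin m → Fin n} (f : ∀ i, A (s i) ⟶ A (t i))

/-- The context `Z₁ : P (dom f₁), …, Zₘ : P (dom fₘ)`. -/
abbrev domCtx (s : Fin m → Fin n) : Ctx C := Ctx.ofFn fun i => Pow (A (s i))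

/-- The variable `Zᵢ`. -/
def domVar (s : Fin m → Fin n) (i : Fin m) : Tm C (domCtx A s) (Pow (A (s i))) :=
  .var (Var.ofFn (fun i => Pow (A (s i))) i)

/-- For terms `Zᵢ : P (A (r i))`, the term of type `P A₁ × ⋯ × P Aₙ` whose `j`-th component is
the union of those `Zᵢ` for which `r i = j`. -/
def collect {Γ : Ctx C} (r : Fin m → Fin n) (Z : ∀ i, Tm C Γ (Pow (A (r i)))) :
    Tm C Γ (prodObj fun j => Pow (A j)) :=
  tuple (X := fun j => Pow (A j)) fun j =>
    unions ((List.finRange m).filterMap fun i => if h : r i = j then some (h ▸ Z i) else none)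

/-- The term `t₀`, with `j`-th component the union of the `Zᵢ` with `dom fᵢ = A j`. -/
def term₀ (s : Fin m → Fin n) : Tm C (domCtx A s) (prodObj fun j => Pow (A j)) :=
  collect A s (domVar A s)

/-- The term `t₁`, with `j`-th component the union of the `fᵢ(Zᵢ)` with `cod fᵢ = A j`. -/
def term₁ : Tm C (domCtx A s) (prodObj fun j => Pow (A j)) :=
  collect A t fun i => image (f i) (domVar A s i)

end Diagram

end Language

/-! ## Interpretation -/

section Semantics

variable {C : Type u} [Category.{v} C] [CartesianMonoidalCategory C] [HasFiniteLimits C]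
  [MonoidalClosed C] [HasSubobjectClassifier C] [HasCountableColimits C]

/-- Variables are interpreted as projections. -/
def Var.interp : ∀ {Γ : Ctx C} {A : C}, Var Γ A → (Γ.obj ⟶ A)
  | .snoc Γ A, _, .zero => (Γ.snocIso A).hom ≫ snd Γ.obj A
  | .snoc Γ A, _, .succ x => (Γ.snocIso A).hom ≫ fst Γ.obj A ≫ x.interp

/-- A subobject of the object of `Γ, A` as a subobject of the product of the object of `Γ`
and `A`. -/
def bindSub (Γ : Ctx C) (A : C) (p : Subobject (Γ.snoc A).obj) : Subobject (Γ.obj ⊗ A) :=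
  (Subobject.pullback (Γ.snocIso A).inv).obj p

mutual

/-- The interpretation `⟦Γ . t⟧` of a term (lifted to the universe of the subobjects, so that it
can be defined together with that of formulas). -/
def Tm.interpLift : ∀ {Γ : Ctx C} {A : C}, Tm C Γ A → ULift.{max u v} (Γ.obj ⟶ A)
  | _, _, .var x => ⟨x.interp⟩
  | _, _, .star => ⟨toUnit _⟩
  | _, _, .pair t s => ⟨lift t.interpLift.down s.interpLift.down⟩
  | _, _, .fst (A := A) (B := B) t => ⟨t.interpLift.down ≫ CartesianMonoidalCategory.fst A B⟩
  | _, _, .snd (A := A) (B := B) t => ⟨t.interpLift.down ≫ CartesianMonoidalCategory.snd A B⟩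
  | _, _, .app f t => ⟨t.interpLift.down ≫ f⟩
  | _, _, .setOf p => ⟨nameOf (bindSub _ _ p.interp)⟩

/-- The interpretation `⟦Γ . p⟧` of a formula. -/
def Fm.interp : ∀ {Γ : Ctx C}, Fm C Γ → Subobject Γ.obj
  | _, .top => ⊤
  | _, .bot => botSub _
  | _, .rel R t => (Subobject.pullback t.interpLift.down).obj R
  | _, .eq t s => equalizerSubobject t.interpLift.down s.interpLift.down
  | _, .mem t T => (Subobject.pullback (lift t.interpLift.down T.interpLift.down)).obj (memSub _)
  | _, .and p q => p.interp ⊓ q.interp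
  | _, .or p q => orSub p.interp q.interp
  | _, .imp p q => impSub p.interp q.interp
  | _, .iSup p => iSupSub fun n => (p n).interp
  | _, .all p => allSub (bindSub _ _ p.interp)
  | _, .ex p => exSub (bindSub _ _ p.interp)

end

/-- The interpretation `⟦Γ . t⟧` of a term. -/
def Tm.interp {Γ : Ctx C} {A : C} (t : Tm C Γ A) : Γ.obj ⟶ A := t.interpLift.down

/-- The coproduct `⟦z : P A₁ × ⋯ × P Aₙ . (A₁ ∐ ⋯ ∐ Aₙ)(z)⟧` described by the internal logic, a
subobject of `Ω ^ A₁ × ⋯ × Ω ^ Aₙ`. -/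
def coprodSub {n : ℕ} (A : Fin n → C) : Subobject (prodObj fun j => Pow (A j)) :=
  (coprodFm (Γ := .snoc .nil (prodObj fun j => Pow (A j))) A (.var .zero)).interp

/-- `⟦a : A j . ⟨∅, …, {a}, …, ∅⟩⟧ : A j ⟶ Ω ^ A₁ × ⋯ × Ω ^ Aₙ`. -/
def injHom {n : ℕ} (A : Fin n → C) (j : Fin n) : A j ⟶ prodObj fun k => Pow (A k) :=
  (inj (Γ := .snoc .nil (A j)) A j (.var .zero)).interp

variable {n m : ℕ} (A : Fin n → C) {s t : Fin m → Fin n} (f : ∀ i, A (s i) ⟶ A (t i))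

/-- `⟦t₀⟧ : Ω ^ dom f₁ × ⋯ × Ω ^ dom fₘ ⟶ Ω ^ A₁ × ⋯ × Ω ^ Aₙ`. -/
def map₀ (s : Fin m → Fin n) :
    (prodObj fun i => Pow (A (s i))) ⟶ prodObj fun j => Pow (A j) :=
  (term₀ A s).interp

/-- `⟦t₁⟧ : Ω ^ dom f₁ × ⋯ × Ω ^ dom fₘ ⟶ Ω ^ A₁ × ⋯ × Ω ^ Aₙ`. -/
def map₁ : (prodObj fun i => Pow (A (s i))) ⟶ prodObj fun j => Pow (A j) :=
  (term₁ A f).interp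

/-- `⟦b : P A₁ × ⋯ × P Aₙ . [b]_{t₀,t₁}⟧`. -/
def classMap : (prodObj fun j => Pow (A j)) ⟶ Pow (prodObj fun j => Pow (A j)) :=
  (classTm (Γ := .snoc .nil (prodObj fun j => Pow (A j)))
    (term₀ A s).unpack (term₁ A f).unpack (.var .zero)).interp

/-- `⟦z . ∃ b : P A₁ × ⋯ × P Aₙ, z = [b]_{t₀,t₁}⟧`, a subobject of `P (P A₁ × ⋯ × P Aₙ)`. -/
def coeqFullSub : Subobject (Pow (prodObj fun j => Pow (A j))) :=
  (coeqFm (Γ := .snoc .nil (Pow (prodObj fun j => Pow (A j))))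
    (term₀ A s).unpack (term₁ A f).unpack (.var .zero)).interp

/-- `⟦z . ∃ b : P A₁ × ⋯ × P Aₙ, (A₁ ∐ ⋯ ∐ Aₙ)(b) ∧ z = [b]_{t₀,t₁}⟧`, a subobject of
`P (P A₁ × ⋯ × P Aₙ)`: the coequaliser of the restrictions of `t₀` and `t₁` to the
coproducts. -/
def coeqSub : Subobject (Pow (prodObj fun j => Pow (A j))) :=
  (coeqOnFm (Γ := .snoc .nil (Pow (prodObj fun j => Pow (A j))))
    (coprodFm A (.var .zero)) (term₀ A s).unpack (term₁ A f).unpack (.var .zero)).interp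

end Semantics

/-- The morphisms `κ j : A j ⟶ L` form a colimit cocone under the finite diagram of the objects
`A j` and the morphisms `f i : A (s i) ⟶ A (t i)`. -/
def IsDiagramColimit {C : Type u} [Category.{v} C] {n m : ℕ} (A : Fin n → C)
    {s t : Fin m → Fin n} (f : ∀ i, A (s i) ⟶ A (t i)) {L : C} (κ : ∀ j, A j ⟶ L) : Prop :=
  (∀ i, f i ≫ κ (t i) = κ (s i)) ∧
    ∀ (X : C) (h : ∀ j, A j ⟶ X), (∀ i, f i ≫ h (t i) = h (s i)) →
      ∃! u : L ⟶ X, ∀ j, κ j ≫ u = h j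

end InternalLogic

end

noncomputable section

namespace InternalLogic

set_option linter.unusedSectionVars false

/-! ## Local truth -/

section Subobjects

variable {C : Type u} [Category.{v} C] {T : C}

theorem subobject_ext {X : C} {p q : Subobject X}
    (h : ∀ {T : C} (x : T ⟶ X), p.Factors x ↔ q.Factors x) : p = q :=
  le_antisymm (Subobject.le_of_factors ((h _).1 p.factors_self))
    (Subobject.le_of_factors ((h _).2 q.factors_self))

theorem mk_factors_iff_exists {X Y W : C} (f : Y ⟶ X) [Mono f] (g : W ⟶ X) :
    (Subobject.mk f).Factors g ↔ ∃ k : W ⟶ Y, k ≫ f = g :=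
  Iff.rfl

theorem comp_arrow_eq_iff {X : C} (p : Subobject X) (x : T ⟶ X) :
    (∃ d : T ⟶ (p : C), d ≫ p.arrow = x) ↔ p.Factors x :=
  ⟨fun ⟨d, e⟩ => e ▸ Subobject.factors_comp_arrow d, fun h => ⟨p.factorThru x h, by simp⟩⟩

theorem eq_top_of_factors_id {r : Subobject T} (h : r.Factors (𝟙 T)) : r = ⊤ :=
  subobject_ext fun x => ⟨fun _ => Subobject.top_factors x,
    fun _ => by simpa using Subobject.factors_of_factors_right x h⟩

/-- A property of the generalised elements of `T` (as stages of definition) holds locally if every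
subobject that contains all the stages at which it holds is everything. -/
def Loc {T : C} (P : ∀ {W : C}, (W ⟶ T) → Prop) : Prop :=
  ∀ r : Subobject T, (∀ {W : C} (g : W ⟶ T), P g → r.Factors g) → r = ⊤

theorem Loc.of_id {P : ∀ {W : C}, (W ⟶ T) → Prop} (h : P (𝟙 T)) : Loc P :=
  fun _ hr => eq_top_of_factors_id (hr _ h)

end Subobjects

section Pullbacks

variable {C : Type u} [Category.{v} C] [HasFiniteLimits C] {T : C}

theorem Loc.factors {P : ∀ {W : C}, (W ⟶ T) → Prop} (hP : Loc P) {X : C} {p : Subobject X}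
    {x : T ⟶ X} (h : ∀ {W : C} (g : W ⟶ T), P g → p.Factors (g ≫ x)) : p.Factors x := by
  have := hP ((Subobject.pullback x).obj p) fun g hg =>
    (Limits.pullback_factors_iff _ _ _).2 (h g hg)
  have e : ((Subobject.pullback x).obj p).Factors (𝟙 T) := this ▸ Subobject.top_factors _
  simpa [Limits.pullback_factors_iff] using e

theorem Loc.eq {P : ∀ {W : C}, (W ⟶ T) → Prop} (hP : Loc P) {X : C} {x y : T ⟶ X}
    (h : ∀ {W : C} (g : W ⟶ T), P g → g ≫ x = g ≫ y) : x = y := by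
  have := hP.factors (p := equalizerSubobject x y) (x := 𝟙 T) fun g hg => by
    rw [Category.comp_id]
    exact equalizerSubobject_factors _ _ _ (h g hg)
  simpa only [Category.id_comp] using (equalizerSubobject_factors_iff _ _ _).1 this

theorem Loc.bind {P Q : ∀ {W : C}, (W ⟶ T) → Prop} (hP : Loc P)
    (h : ∀ {W : C} (g : W ⟶ T), P g → Loc fun k => Q (k ≫ g)) : Loc Q := fun r hr =>
  hP r fun g hg => (h g hg).factors fun _ hk => hr _ hk

theorem Loc.mono {P Q : ∀ {W : C}, (W ⟶ T) → Prop} (hP : Loc P)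
    (h : ∀ {W : C} (g : W ⟶ T), P g → Q g) : Loc Q :=
  hP.bind fun g hg => .of_id (by simpa using h g hg)

theorem imSub_factors_self [HasCountableColimits C] {X Y : C} (f : X ⟶ Y) : (imSub f).Factors f :=
  equalizerSubobject_factors _ _ _ pushout.condition

theorem truth_factors_iff [HasSubobjectClassifier C] {X T : C} (p : Subobject X) (x : T ⟶ X) :
    (Subobject.mk (HasSubobjectClassifier.truth C)).Factors (x ≫ chi p) ↔ p.Factors x := by
  rw [← Limits.pullback_factors_iff]
  have := Subobject.Classifier.pullback_χ_obj_mk_truth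
    (HasSubobjectClassifier.exists_classifier (C := C)).some p.arrow
  rw [Subobject.mk_arrow] at this
  exact iff_of_eq (congrArg (fun q => Subobject.Factors q x) this)

theorem omega_ext [HasSubobjectClassifier C] {X : C} {φ ψ : X ⟶ HasSubobjectClassifier.Ω C}
    (h : ∀ {T : C} (x : T ⟶ X),
      (Subobject.mk (HasSubobjectClassifier.truth C)).Factors (x ≫ φ) ↔
        (Subobject.mk (HasSubobjectClassifier.truth C)).Factors (x ≫ ψ)) : φ = ψ := by
  have key : ∀ θ : X ⟶ HasSubobjectClassifier.Ω C, θ = chi ((Subobject.pullback θ).obj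
      (Subobject.mk (HasSubobjectClassifier.truth C))) := fun θ =>
    (Subobject.Classifier.χ_pullback_obj_mk_truth_arrow
      (HasSubobjectClassifier.exists_classifier (C := C)).some θ).symm
  rw [key φ, key ψ]
  congr 1
  refine subobject_ext fun x => ?_
  simpa only [Limits.pullback_factors_iff] using h x

end Pullbacks

section Local

variable {C : Type u} [Category.{v} C] [CartesianMonoidalCategory C] [HasFiniteLimits C]
  [MonoidalClosed C] [HasSubobjectClassifier C]

/-- Membership of a generalised element in a generalised subset. -/
def Mem {A T : C} (a : T ⟶ A) (S : T ⟶ Pow A) : Prop := (memSub A).Factors (lift a S)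

theorem mem_iff {A T W : C} (a : W ⟶ A) (h : W ⟶ T) (S : T ⟶ Pow A) :
    Mem a (h ≫ S) ↔ (Subobject.mk (HasSubobjectClassifier.truth C)).Factors
      (lift a h ≫ MonoidalClosed.uncurry S) := by
  rw [Mem, memSub, Limits.pullback_factors_iff, MonoidalClosed.uncurry_eq]
  simp only [Functor.id_obj, lift_whiskerLeft_assoc]

theorem mem_nameOf {Y A T : C} (p : Subobject (Y ⊗ A)) (y : T ⟶ Y) (a : T ⟶ A) :
    Mem a (y ≫ nameOf p) ↔ p.Factors (lift y a) := by
  rw [mem_iff, nameOf, MonoidalClosed.uncurry_curry, ← truth_factors_iff p]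
  simp [-Subobject.mk_factors_iff, comp_lift_assoc]

theorem Mem.comp {A T W : C} {a : T ⟶ A} {S : T ⟶ Pow A} (h : Mem a S) (g : W ⟶ T) :
    Mem (g ≫ a) (g ≫ S) := by
  rw [Mem, ← comp_lift]
  exact Subobject.factors_of_factors_right g h

theorem pow_ext {A T : C} {S S' : T ⟶ Pow A}
    (h : ∀ {W : C} (g : W ⟶ T) (a : W ⟶ A), Mem a (g ≫ S) ↔ Mem a (g ≫ S')) : S = S' := by
  apply MonoidalClosed.uncurry_injective
  refine omega_ext fun {W} x => ?_
  have := h (x ≫ snd A T) (x ≫ fst A T)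
  rw [mem_iff, mem_iff] at this
  have e : lift (x ≫ fst A T) (x ≫ snd A T) = x := by ext <;> simp
  rwa [e] at this

/-- The universal quantification of a subobject along a morphism. -/
def forallSub {T X : C} (x : T ⟶ X) (r : Subobject T) : Subobject X :=
  equalizerSubobject (nameOf (Subobject.mk (lift x (𝟙 T))))
    (nameOf (Subobject.mk (r.arrow ≫ lift x (𝟙 T))))

theorem forallSub_factors_iff {T X Y : C} (x : T ⟶ X) (r : Subobject T) (y : Y ⟶ X) :
    (forallSub x r).Factors y ↔
      ∀ {W : C} (g : W ⟶ T) (h : W ⟶ Y), g ≫ x = h ≫ y → r.Factors g := by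
  rw [forallSub, equalizerSubobject_factors_iff]
  have h₁ : ∀ {W : C} (h : W ⟶ Y) (g : W ⟶ T),
      Mem g (h ≫ y ≫ nameOf (Subobject.mk (lift x (𝟙 T)))) ↔ g ≫ x = h ≫ y := by
    intro W h g
    rw [← Category.assoc, mem_nameOf, mk_factors_iff_exists]
    constructor
    · rintro ⟨k, hk⟩
      have e₁ := hk =≫ fst _ _
      have e₂ := hk =≫ snd _ _
      simp only [Category.assoc, lift_fst, lift_snd, Category.comp_id]
        at e₁ e₂
      rw [← e₁, ← e₂]
    · intro e
      exact ⟨g, by ext <;> simp [e]⟩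
  have h₂ : ∀ {W : C} (h : W ⟶ Y) (g : W ⟶ T),
      Mem g (h ≫ y ≫ nameOf (Subobject.mk (r.arrow ≫ lift x (𝟙 T)))) ↔
        g ≫ x = h ≫ y ∧ r.Factors g := by
    intro W h g
    rw [← Category.assoc, mem_nameOf, mk_factors_iff_exists]
    constructor
    · rintro ⟨k, hk⟩
      have e₁ := hk =≫ fst _ _
      have e₂ := hk =≫ snd _ _
      simp only [Category.assoc, lift_fst, lift_snd, Category.comp_id]
        at e₁ e₂
      refine ⟨by rw [← e₁, ← e₂, Category.assoc], ?_⟩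
      rw [← e₂]
      exact Subobject.factors_comp_arrow k
    · rintro ⟨e, hr⟩
      exact ⟨r.factorThru g hr, by ext <;> simp [e]⟩
  constructor
  · intro e W g h hg
    exact ((h₂ h g).1 (e ▸ (h₁ h g).2 hg)).2
  · intro H
    refine pow_ext fun {W} h g => ?_
    rw [h₁, h₂]
    exact ⟨fun e => ⟨e, H g h e⟩, And.left⟩

variable {T : C}

theorem Loc.mem {P : ∀ {W : C}, (W ⟶ T) → Prop} (hP : Loc P) {A : C} {a : T ⟶ A} {S : T ⟶ Pow A}
    (h : ∀ {W : C} (g : W ⟶ T), P g → Mem (g ≫ a) (g ≫ S)) : Mem a S :=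
  hP.factors fun g hg => by simpa [Mem, comp_lift] using h g hg

theorem Loc.pull {P : ∀ {W : C}, (W ⟶ T) → Prop} (hP : Loc P)
    (hP' : ∀ {W V : C} (g : W ⟶ T) (k : V ⟶ W), P g → P (k ≫ g)) {Y : C} (y : Y ⟶ T) :
    Loc fun k => P (k ≫ y) := by
  intro r hr
  apply eq_top_of_factors_id
  have := hP.factors (p := forallSub y r) (x := 𝟙 T) fun g hg => by
    rw [forallSub_factors_iff]
    intro W k h e
    refine hr k ?_
    change P (k ≫ y)
    rw [e, Category.comp_id]
    exact hP' _ _ hg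
  exact (forallSub_factors_iff y r (𝟙 T)).1 this (𝟙 Y) y (by simp)

/-- A least subobject containing given generalised elements consists of those generalised elements
that locally come from the given ones. -/
theorem factors_iff_of_isLeast {ι : Sort*} {X : C} {D : ι → C} (φ : ∀ i, D i ⟶ X)
    {q : Subobject X} (hq : ∀ i, q.Factors (φ i))
    (hle : ∀ r : Subobject X, (∀ i, r.Factors (φ i)) → q ≤ r) (x : T ⟶ X) :
    q.Factors x ↔ Loc fun {W} (g : W ⟶ T) => ∃ (i : ι) (d : W ⟶ D i), d ≫ φ i = g ≫ x := by
  constructor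
  · intro hx r hr
    apply eq_top_of_factors_id
    have : q ≤ forallSub x r := hle _ fun i => by
      rw [forallSub_factors_iff]
      exact fun g h e => hr g ⟨i, h, e.symm⟩
    exact (forallSub_factors_iff x r x).1 (Subobject.factors_of_le x this hx) _ (𝟙 T) rfl
  · intro h
    refine h.factors ?_
    rintro W g ⟨i, d, e⟩
    rw [← e]
    exact Subobject.factors_of_factors_right d (hq i)

theorem impSub_factors_iff {X : C} (p q : Subobject X) (x : T ⟶ X) :
    (impSub p q).Factors x ↔ ∀ {W : C} (g : W ⟶ T), p.Factors (g ≫ x) → q.Factors (g ≫ x) := by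
  rw [impSub, equalizerSubobject_factors_iff]
  constructor
  · intro e W g hg
    rw [← truth_factors_iff, Category.assoc, ← e, ← Category.assoc, truth_factors_iff,
      Subobject.inf_factors] at hg
    exact hg.2
  · intro h
    refine omega_ext fun {W} g => ?_
    rw [← Category.assoc, ← Category.assoc, truth_factors_iff, truth_factors_iff,
      Subobject.inf_factors]
    exact ⟨And.left, fun hg => ⟨hg, h g hg⟩⟩

theorem allSub_factors_iff {Y A : C} (p : Subobject (Y ⊗ A)) (y : T ⟶ Y) :
    (allSub p).Factors y ↔ ∀ {W : C} (g : W ⟶ T) (a : W ⟶ A), p.Factors (lift (g ≫ y) a) := by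
  rw [allSub, equalizerSubobject_factors_iff]
  constructor
  · intro e W g a
    rw [← mem_nameOf, Category.assoc, e, ← Category.assoc, mem_nameOf]
    exact Subobject.top_factors _
  · intro h
    refine pow_ext fun {W} g a => ?_
    rw [← Category.assoc, ← Category.assoc, mem_nameOf, mem_nameOf]
    exact ⟨fun _ => Subobject.top_factors _, fun _ => h g a⟩

end Local

section Images

variable {C : Type u} [Category.{v} C] [CartesianMonoidalCategory C] [HasFiniteLimits C]
  [MonoidalClosed C] [HasSubobjectClassifier C] [HasCountableColimits C] {T : C}

theorem imSub_le {X Y : C} (f : X ⟶ Y) {r : Subobject Y} (h : r.Factors f) : imSub f ≤ r := by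
  have e : f ≫ chi r = f ≫ chi ⊤ := omega_ext fun x => by
    rw [← Category.assoc, ← Category.assoc, truth_factors_iff, truth_factors_iff]
    exact ⟨fun _ => Subobject.top_factors _, fun _ => Subobject.factors_of_factors_right x h⟩
  apply Subobject.le_of_factors
  have w : (imSub f).arrow ≫ pushout.inl f f = (imSub f).arrow ≫ pushout.inr f f :=
    equalizerSubobject_arrow_comp _ _
  have w' := w =≫ pushout.desc _ _ e
  simp only [Category.assoc, pushout.inl_desc, pushout.inr_desc] at w'
  rw [← truth_factors_iff, w', truth_factors_iff]
  exact Subobject.top_factors _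

theorem imSub_factors_iff {X Y : C} (f : X ⟶ Y) (y : T ⟶ Y) :
    (imSub f).Factors y ↔ Loc fun {W} (g : W ⟶ T) => ∃ d : W ⟶ X, d ≫ f = g ≫ y := by
  rw [factors_iff_of_isLeast (ι := Unit) (fun _ => f) (fun _ => imSub_factors_self f)
    fun r hr => imSub_le f (hr ())]
  simp

theorem imSub_sigmaDesc_factors_iff {ι : Type} [Countable ι] {D : ι → C} {X : C}
    (φ : ∀ i, D i ⟶ X) (x : T ⟶ X) :
    (imSub (Sigma.desc φ)).Factors x ↔
      Loc fun {W} (g : W ⟶ T) => ∃ (i : ι) (d : W ⟶ D i), d ≫ φ i = g ≫ x := by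
  refine factors_iff_of_isLeast φ (fun i => ?_) (fun r hr => imSub_le _ ?_) x
  · rw [← Sigma.ι_desc φ i]
    exact Subobject.factors_of_factors_right _ (imSub_factors_self _)
  · have : Sigma.desc φ = Sigma.desc (fun i => r.factorThru (φ i) (hr i)) ≫ r.arrow := by
      ext i
      simp
    rw [this]
    exact Subobject.factors_comp_arrow _

theorem iSupSub_factors_iff {X : C} (p : ℕ → Subobject X) (x : T ⟶ X) :
    (iSupSub p).Factors x ↔ Loc fun {W} (g : W ⟶ T) => ∃ n, (p n).Factors (g ≫ x) := by
  rw [iSupSub, imSub_sigmaDesc_factors_iff]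
  simp only [comp_arrow_eq_iff]

theorem orSub_factors_iff {X : C} (p q : Subobject X) (x : T ⟶ X) :
    (orSub p q).Factors x ↔
      Loc fun {W} (g : W ⟶ T) => p.Factors (g ≫ x) ∨ q.Factors (g ≫ x) := by
  rw [factors_iff_of_isLeast (ι := Bool) (D := fun b => ((cond b p q : Subobject X) : C))
    (fun b => (cond b p q).arrow)]
  · simp only [comp_arrow_eq_iff, Bool.exists_bool, cond_true, cond_false, or_comm]
  · rintro (_ | _)
    · have := Subobject.factors_of_factors_right coprod.inr
        (imSub_factors_self (coprod.desc p.arrow q.arrow))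
      rwa [coprod.inr_desc] at this
    · have := Subobject.factors_of_factors_right coprod.inl
        (imSub_factors_self (coprod.desc p.arrow q.arrow))
      rwa [coprod.inl_desc] at this
  · intro r hr
    apply imSub_le
    have : coprod.desc p.arrow q.arrow =
        coprod.desc (r.factorThru _ (hr true)) (r.factorThru _ (hr false)) ≫ r.arrow := by
      ext <;> simp
    rw [this]
    exact Subobject.factors_comp_arrow _

theorem botSub_factors_iff {X : C} (x : T ⟶ X) :
    (botSub X).Factors x ↔ Loc fun {W} (_ : W ⟶ T) => False := by
  rw [factors_iff_of_isLeast (ι := Empty) (D := fun _ => X) (fun _ => 𝟙 X) (fun i => i.elim)]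
  · simp
  · intro r _
    apply imSub_le
    rw [Subsingleton.elim (initial.to X) (initial.to (r : C) ≫ r.arrow)]
    exact Subobject.factors_comp_arrow _

theorem exSub_factors_iff {Y A : C} (p : Subobject (Y ⊗ A)) (y : T ⟶ Y) :
    (exSub p).Factors y ↔
      Loc fun {W} (g : W ⟶ T) => ∃ a : W ⟶ A, p.Factors (lift (g ≫ y) a) := by
  have key : ∀ {W : C} (g : W ⟶ T), (∃ d : W ⟶ (p : C), d ≫ p.arrow ≫ fst Y A = g ≫ y) ↔
      ∃ a : W ⟶ A, p.Factors (lift (g ≫ y) a) := by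
    intro W g
    constructor
    · rintro ⟨d, e⟩
      refine ⟨d ≫ p.arrow ≫ snd Y A, ?_⟩
      rw [← e, ← comp_lift, ← comp_lift]
      simpa using Subobject.factors_comp_arrow d
    · rintro ⟨a, h⟩
      exact ⟨p.factorThru _ h, by simp⟩
  rw [exSub, imSub_factors_iff]
  simp only [key]

/-- Gluing of a compatible family of morphisms along a jointly covering family. -/
theorem existsUnique_desc {ι : Type} [Countable ι] {A : ι → C} {U X : C} (e : ∀ j, A j ⟶ U)
    (he : Loc fun {W} (g : W ⟶ U) => ∃ (j : ι) (d : W ⟶ A j), d ≫ e j = g) (h : ∀ j, A j ⟶ X)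
    (hh : ∀ {W : C} (j k : ι) (a : W ⟶ A j) (b : W ⟶ A k), a ≫ e j = b ≫ e k →
      a ≫ h j = b ≫ h k) :
    ∃! w : U ⟶ X, ∀ j, e j ≫ w = h j := by
  let G : Subobject (U ⊗ X) := imSub (Sigma.desc fun j => lift (e j) (h j))
  have hG : ∀ {W : C} (x : W ⟶ U ⊗ X), G.Factors x ↔ Loc fun {V} (g : V ⟶ W) =>
      ∃ (j : ι) (d : V ⟶ A j), d ≫ lift (e j) (h j) = g ≫ x :=
    imSub_sigmaDesc_factors_iff _
  have hmono : Mono (G.arrow ≫ fst U X) := by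
    refine ⟨fun {W} a b hab => ?_⟩
    rw [← cancel_mono G.arrow]
    simp only [← Category.assoc] at hab
    have ha := (hG _).1 (Subobject.factors_comp_arrow a)
    have hb := (hG _).1 (Subobject.factors_comp_arrow b)
    refine ha.eq ?_
    rintro V g ⟨j, d, hd⟩
    refine (hb.pull ?_ g).eq ?_
    · rintro V V' g k ⟨j, d, hd⟩
      exact ⟨j, k ≫ d, by rw [Category.assoc, hd, Category.assoc]⟩
    · rintro V' k ⟨j', d', hd'⟩
      have e₁ := hd =≫ fst _ _
      have e₂ := hd =≫ snd _ _
      have e₁' := hd' =≫ fst _ _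
      have e₂' := hd' =≫ snd _ _
      simp only [Category.assoc, lift_fst, lift_snd] at e₁ e₂ e₁' e₂' hab
      have := hh j j' (k ≫ d) d' (by
        rw [e₁', ← hab, Category.assoc, e₁])
      ext
      · simp [hab]
      · simp only [Category.assoc]
        rw [← e₂', ← this, Category.assoc, e₂]
  have hjG : ∀ j, G.Factors (lift (e j) (h j)) := fun j =>
    (hG _).2 (.of_id ⟨j, 𝟙 _, by simp⟩)
  have htop := he (Subobject.mk (G.arrow ≫ fst U X)) (by
    rintro W g ⟨j, d, rfl⟩
    exact ⟨d ≫ G.factorThru _ (hjG j), by simp⟩)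
  have hiso : IsIso (G.arrow ≫ fst U X) := (Subobject.isIso_iff_mk_eq_top _).2 htop
  have hinv : ∀ {Z : C} (z : (G : C) ⟶ Z),
      G.arrow ≫ fst U X ≫ inv (G.arrow ≫ fst U X) ≫ z = z := fun z => by
    rw [← Category.assoc, ← Category.assoc, IsIso.hom_inv_id, Category.id_comp]
  refine ⟨inv (G.arrow ≫ fst U X) ≫ G.arrow ≫ snd U X, fun j => ?_, fun w hw => ?_⟩
  · have : e j = G.factorThru _ (hjG j) ≫ G.arrow ≫ fst U X := by simp
    calc _ = (G.factorThru _ (hjG j) ≫ G.arrow ≫ fst U X) ≫ inv (G.arrow ≫ fst U X) ≫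
          G.arrow ≫ snd U X := by rw [← this]
      _ = G.factorThru _ (hjG j) ≫ G.arrow ≫ snd U X := by simp only [Category.assoc, hinv]
      _ = _ := by simp
  · refine he.eq ?_
    rintro W g ⟨j, d, rfl⟩
    have : e j = G.factorThru _ (hjG j) ≫ G.arrow ≫ fst U X := by simp
    calc _ = d ≫ h j := by rw [Category.assoc, hw]
      _ = d ≫ (G.factorThru _ (hjG j) ≫ G.arrow ≫ fst U X) ≫ inv (G.arrow ≫ fst U X) ≫
          G.arrow ≫ snd U X := by
        simp only [Category.assoc, hinv]
        simp
      _ = _ := by rw [← this, Category.assoc]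

end Images

/-! ## Kripke–Joyal semantics -/

section Environments

variable {C : Type u} [Category.{v} C] [CartesianMonoidalCategory C]

/-- The generalised element of the object of `Γ, A` with given components. -/
def env {Γ : Ctx C} {A T : C} (ρ : T ⟶ Γ.obj) (a : T ⟶ A) : T ⟶ (Γ.snoc A).obj :=
  lift ρ a ≫ (Γ.snocIso A).inv

variable {Γ Δ : Ctx C} {A B T W : C}

theorem comp_env (g : W ⟶ T) (ρ : T ⟶ Γ.obj) (a : T ⟶ A) :
    g ≫ env ρ a = env (g ≫ ρ) (g ≫ a) := by
  simp [env, comp_lift_assoc]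

theorem env_zero (ρ : T ⟶ Γ.obj) (a : T ⟶ A) : env ρ a ≫ (Var.zero (Γ := Γ)).interp = a := by
  simp [env, Var.interp]

theorem env_succ (ρ : T ⟶ Γ.obj) (a : T ⟶ A) (x : Var Γ B) :
    env ρ a ≫ (Var.succ x).interp = ρ ≫ x.interp := by
  simp [env, Var.interp]

/-- The morphism that replaces the first component of an object of `Γ, A`. -/
def liftHom (u : Δ.obj ⟶ Γ.obj) (B : C) : (Δ.snoc B).obj ⟶ (Γ.snoc B).obj :=
  (Δ.snocIso B).hom ≫ u ▷ B ≫ (Γ.snocIso B).inv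

theorem env_liftHom (u : Δ.obj ⟶ Γ.obj) (ρ : T ⟶ Δ.obj) (a : T ⟶ B) :
    env ρ a ≫ liftHom u B = env (ρ ≫ u) a := by
  simp [env, liftHom]

theorem liftHom_zero (u : Δ.obj ⟶ Γ.obj) :
    liftHom u B ≫ (Var.zero (Γ := Γ)).interp = (Var.zero (Γ := Δ) (A := B)).interp := by
  simp [liftHom, Var.interp]

theorem liftHom_succ (u : Δ.obj ⟶ Γ.obj) (x : Var Γ A) :
    liftHom u B ≫ (Var.succ x).interp =
      (Δ.snocIso B).hom ≫ fst Δ.obj B ≫ u ≫ x.interp := by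
  simp [liftHom, Var.interp]

end Environments

section Forcing

variable {C : Type u} [Category.{v} C] [CartesianMonoidalCategory C] [HasFiniteLimits C]
  [MonoidalClosed C] [HasSubobjectClassifier C] [HasCountableColimits C]

variable {Γ Δ : Ctx C} {A B T : C}

theorem bindSub_factors_iff (p : Subobject (Γ.snoc A).obj) (ρ : T ⟶ Γ.obj) (a : T ⟶ A) :
    (bindSub Γ A p).Factors (lift ρ a) ↔ p.Factors (env ρ a) :=
  Limits.pullback_factors_iff _ _ _

namespace Tm

@[simp]
theorem interp_var (x : Var Γ A) : (Tm.var x).interp = x.interp := by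
  simp only [interp, interpLift]

@[simp]
theorem interp_star : (Tm.star (C := C) (Γ := Γ)).interp = toUnit _ := by
  simp only [interp, interpLift]

@[simp]
theorem interp_pair (t : Tm C Γ A) (s : Tm C Γ B) :
    (Tm.pair t s).interp = lift t.interp s.interp := by
  simp only [interp, interpLift]

@[simp]
theorem interp_fst (t : Tm C Γ (A ⊗ B)) :
    (Tm.fst t).interp = t.interp ≫ CartesianMonoidalCategory.fst A B := by
  simp only [interp, interpLift]

@[simp]
theorem interp_snd (t : Tm C Γ (A ⊗ B)) :
    (Tm.snd t).interp = t.interp ≫ CartesianMonoidalCategory.snd A B := by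
  simp only [interp, interpLift]

@[simp]
theorem interp_app (f : A ⟶ B) (t : Tm C Γ A) : (Tm.app f t).interp = t.interp ≫ f := by
  simp only [interp, interpLift]

theorem mem_setOf (p : Fm C (Γ.snoc A)) (ρ : T ⟶ Γ.obj) (a : T ⟶ A) :
    Mem a (ρ ≫ (Tm.setOf p).interp) ↔ p.interp.Factors (env ρ a) := by
  simp only [interp, interpLift]
  rw [mem_nameOf, bindSub_factors_iff]

end Tm

namespace Fm

theorem top_factors (ρ : T ⟶ Γ.obj) : (Fm.top : Fm C Γ).interp.Factors ρ := by
  simp only [interp]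
  exact Subobject.top_factors ρ

theorem bot_factors (ρ : T ⟶ Γ.obj) :
    (Fm.bot : Fm C Γ).interp.Factors ρ ↔ Loc fun {W} (_ : W ⟶ T) => False := by
  simp only [interp]
  exact botSub_factors_iff ρ

theorem rel_factors (R : Subobject A) (t : Tm C Γ A) (ρ : T ⟶ Γ.obj) :
    (Fm.rel R t).interp.Factors ρ ↔ R.Factors (ρ ≫ t.interp) := by
  simp only [interp, Limits.pullback_factors_iff, Tm.interp]

theorem eq_factors (t s : Tm C Γ A) (ρ : T ⟶ Γ.obj) :
    (Fm.eq t s).interp.Factors ρ ↔ ρ ≫ t.interp = ρ ≫ s.interp := by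
  simp only [interp, equalizerSubobject_factors_iff, Tm.interp]

theorem mem_factors (t : Tm C Γ A) (S : Tm C Γ (Pow A)) (ρ : T ⟶ Γ.obj) :
    (Fm.mem t S).interp.Factors ρ ↔ Mem (ρ ≫ t.interp) (ρ ≫ S.interp) := by
  simp only [interp, Limits.pullback_factors_iff, Tm.interp, Mem, comp_lift]

theorem and_factors (p q : Fm C Γ) (ρ : T ⟶ Γ.obj) :
    (Fm.and p q).interp.Factors ρ ↔ p.interp.Factors ρ ∧ q.interp.Factors ρ := by
  simp only [interp, Subobject.inf_factors]

theorem or_factors (p q : Fm C Γ) (ρ : T ⟶ Γ.obj) :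
    (Fm.or p q).interp.Factors ρ ↔ Loc fun {W} (g : W ⟶ T) =>
      p.interp.Factors (g ≫ ρ) ∨ q.interp.Factors (g ≫ ρ) := by
  simp only [interp, orSub_factors_iff]

theorem imp_factors (p q : Fm C Γ) (ρ : T ⟶ Γ.obj) :
    (Fm.imp p q).interp.Factors ρ ↔ ∀ {W : C} (g : W ⟶ T),
      p.interp.Factors (g ≫ ρ) → q.interp.Factors (g ≫ ρ) := by
  simp only [interp, impSub_factors_iff]

theorem iSup_factors (p : ℕ → Fm C Γ) (ρ : T ⟶ Γ.obj) :
    (Fm.iSup p).interp.Factors ρ ↔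
      Loc fun {W} (g : W ⟶ T) => ∃ n, (p n).interp.Factors (g ≫ ρ) := by
  simp only [interp, iSupSub_factors_iff]

theorem all_factors (p : Fm C (Γ.snoc A)) (ρ : T ⟶ Γ.obj) :
    (Fm.all p).interp.Factors ρ ↔
      ∀ {W : C} (g : W ⟶ T) (a : W ⟶ A), p.interp.Factors (env (g ≫ ρ) a) := by
  simp only [interp, allSub_factors_iff, bindSub_factors_iff]

theorem ex_factors (p : Fm C (Γ.snoc A)) (ρ : T ⟶ Γ.obj) :
    (Fm.ex p).interp.Factors ρ ↔
      Loc fun {W} (g : W ⟶ T) => ∃ a : W ⟶ A, p.interp.Factors (env (g ≫ ρ) a) := by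
  simp only [interp, exSub_factors_iff, bindSub_factors_iff]

end Fm

theorem Ren.lift_interp {ρ : Ren Γ Δ} {u : Δ.obj ⟶ Γ.obj}
    (h : ∀ A (x : Var Γ A), (ρ A x).interp = u ≫ x.interp) (B : C) :
    ∀ A (x : Var (Γ.snoc B) A), (ρ.lift B A x).interp = liftHom u B ≫ x.interp
  | _, .zero => (liftHom_zero u).symm
  | _, .succ x => by rw [liftHom_succ, ← h, Ren.lift, Var.interp]

mutual

theorem Tm.interp_ren : ∀ {Γ : Ctx C} {A : C} (t : Tm C Γ A) {Δ : Ctx C} {ρ : Ren Γ Δ}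
    {u : Δ.obj ⟶ Γ.obj}, (∀ A (x : Var Γ A), (ρ A x).interp = u ≫ x.interp) →
      (t.ren ρ).interp = u ≫ t.interp
  | _, _, .var x, _, _, _, h => by simp [Tm.ren, h]
  | _, _, .star, _, _, _, _ => by simp [Tm.ren]
  | _, _, .pair t s, _, _, _, h => by
    simp [Tm.ren, Tm.interp_ren t h, Tm.interp_ren s h, comp_lift]
  | _, _, .fst t, _, _, _, h => by simp [Tm.ren, Tm.interp_ren t h]
  | _, _, .snd t, _, _, _, h => by simp [Tm.ren, Tm.interp_ren t h]
  | _, _, .app f t, _, _, _, h => by simp [Tm.ren, Tm.interp_ren t h]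
  | _, _, .setOf p, _, _, u, h => pow_ext fun g a => by
    rw [Tm.ren, Tm.mem_setOf, Fm.ren_factors p (Ren.lift_interp h _), env_liftHom,
      ← Category.assoc, Tm.mem_setOf]

theorem Fm.ren_factors : ∀ {Γ : Ctx C} (p : Fm C Γ) {Δ : Ctx C} {ρ : Ren Γ Δ}
    {u : Δ.obj ⟶ Γ.obj}, (∀ A (x : Var Γ A), (ρ A x).interp = u ≫ x.interp) →
      ∀ {T : C} {x : T ⟶ Δ.obj}, (p.ren ρ).interp.Factors x ↔ p.interp.Factors (x ≫ u)
  | _, .top, _, _, _, _, _, _ => by simp [Fm.ren, Fm.top_factors]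
  | _, .bot, _, _, _, _, _, _ => by simp [Fm.ren, Fm.bot_factors]
  | _, .rel R t, _, _, _, h, _, _ => by simp [Fm.ren, Fm.rel_factors, Tm.interp_ren t h]
  | _, .eq t s, _, _, _, h, _, _ => by
    simp [Fm.ren, Fm.eq_factors, Tm.interp_ren t h, Tm.interp_ren s h]
  | _, .mem t S, _, _, _, h, _, _ => by
    simp [Fm.ren, Fm.mem_factors, Tm.interp_ren t h, Tm.interp_ren S h]
  | _, .and p q, _, _, _, h, _, _ => by
    simp [Fm.ren, Fm.and_factors, Fm.ren_factors p h, Fm.ren_factors q h]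
  | _, .or p q, _, _, _, h, _, _ => by
    simp [Fm.ren, Fm.or_factors, Fm.ren_factors p h, Fm.ren_factors q h]
  | _, .imp p q, _, _, _, h, _, _ => by
    simp [Fm.ren, Fm.imp_factors, Fm.ren_factors p h, Fm.ren_factors q h]
  | Γ, .iSup p, Δ, σ, u, h, _, _ => by
    have H : ∀ n {T : C} (x : T ⟶ Δ.obj), ((p n).ren σ).interp.Factors x ↔
      (p n).interp.Factors (x ≫ u) := fun n _ _ => Fm.ren_factors (p n) h
    simp [Fm.ren, Fm.iSup_factors, H]
  | _, .all p, _, _, _, h, _, _ => by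
    simp [Fm.ren, Fm.all_factors, Fm.ren_factors p (Ren.lift_interp h _), env_liftHom]
  | _, .ex p, _, _, _, h, _, _ => by
    simp [Fm.ren, Fm.ex_factors, Fm.ren_factors p (Ren.lift_interp h _), env_liftHom]

end

theorem Tm.interp_wk (t : Tm C Γ A) (B : C) :
    (t.wk B).interp = (Γ.snocIso B).hom ≫ CartesianMonoidalCategory.fst Γ.obj B ≫ t.interp := by
  rw [Tm.wk, Tm.interp_ren t (u := (Γ.snocIso B).hom ≫ CartesianMonoidalCategory.fst Γ.obj B),
    Category.assoc]
  intro A x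
  rw [Var.interp, Category.assoc]

theorem Tm.env_wk (t : Tm C Γ A) (ρ : T ⟶ Γ.obj) (b : T ⟶ B) :
    env ρ b ≫ (t.wk B).interp = ρ ≫ t.interp := by
  simp [Tm.interp_wk, env]

theorem Sub.lift_interp {σ : Sub Γ Δ} {u : Δ.obj ⟶ Γ.obj}
    (h : ∀ A (x : Var Γ A), (σ A x).interp = u ≫ x.interp) (B : C) :
    ∀ A (x : Var (Γ.snoc B) A), (σ.lift B A x).interp = liftHom u B ≫ x.interp
  | _, .zero => by rw [liftHom_zero, Sub.lift, Tm.interp_var]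
  | _, .succ x => by rw [liftHom_succ, ← h, Sub.lift, Tm.interp_wk]

mutual

theorem Tm.interp_subst : ∀ {Γ : Ctx C} {A : C} (t : Tm C Γ A) {Δ : Ctx C} {σ : Sub Γ Δ}
    {u : Δ.obj ⟶ Γ.obj}, (∀ A (x : Var Γ A), (σ A x).interp = u ≫ x.interp) →
      (t.subst σ).interp = u ≫ t.interp
  | _, _, .var x, _, _, _, h => by simp [Tm.subst, h]
  | _, _, .star, _, _, _, _ => by simp [Tm.subst]
  | _, _, .pair t s, _, _, _, h => by
    simp [Tm.subst, Tm.interp_subst t h, Tm.interp_subst s h, comp_lift]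
  | _, _, .fst t, _, _, _, h => by simp [Tm.subst, Tm.interp_subst t h]
  | _, _, .snd t, _, _, _, h => by simp [Tm.subst, Tm.interp_subst t h]
  | _, _, .app f t, _, _, _, h => by simp [Tm.subst, Tm.interp_subst t h]
  | _, _, .setOf p, _, _, u, h => pow_ext fun g a => by
    rw [Tm.subst, Tm.mem_setOf, Fm.subst_factors p (Sub.lift_interp h _), env_liftHom,
      ← Category.assoc, Tm.mem_setOf]

theorem Fm.subst_factors : ∀ {Γ : Ctx C} (p : Fm C Γ) {Δ : Ctx C} {σ : Sub Γ Δ}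
    {u : Δ.obj ⟶ Γ.obj}, (∀ A (x : Var Γ A), (σ A x).interp = u ≫ x.interp) →
      ∀ {T : C} {x : T ⟶ Δ.obj}, (p.subst σ).interp.Factors x ↔ p.interp.Factors (x ≫ u)
  | _, .top, _, _, _, _, _, _ => by simp [Fm.subst, Fm.top_factors]
  | _, .bot, _, _, _, _, _, _ => by simp [Fm.subst, Fm.bot_factors]
  | _, .rel R t, _, _, _, h, _, _ => by simp [Fm.subst, Fm.rel_factors, Tm.interp_subst t h]
  | _, .eq t s, _, _, _, h, _, _ => by
    simp [Fm.subst, Fm.eq_factors, Tm.interp_subst t h, Tm.interp_subst s h]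
  | _, .mem t S, _, _, _, h, _, _ => by
    simp [Fm.subst, Fm.mem_factors, Tm.interp_subst t h, Tm.interp_subst S h]
  | _, .and p q, _, _, _, h, _, _ => by
    simp [Fm.subst, Fm.and_factors, Fm.subst_factors p h, Fm.subst_factors q h]
  | _, .or p q, _, _, _, h, _, _ => by
    simp [Fm.subst, Fm.or_factors, Fm.subst_factors p h, Fm.subst_factors q h]
  | _, .imp p q, _, _, _, h, _, _ => by
    simp [Fm.subst, Fm.imp_factors, Fm.subst_factors p h, Fm.subst_factors q h]
  | Γ, .iSup p, Δ, σ, u, h, _, _ => by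
    have H : ∀ n {T : C} (x : T ⟶ Δ.obj), ((p n).subst σ).interp.Factors x ↔
      (p n).interp.Factors (x ≫ u) := fun n _ _ => Fm.subst_factors (p n) h
    simp [Fm.subst, Fm.iSup_factors, H]
  | _, .all p, _, _, _, h, _, _ => by
    simp [Fm.subst, Fm.all_factors, Fm.subst_factors p (Sub.lift_interp h _), env_liftHom]
  | _, .ex p, _, _, _, h, _, _ => by
    simp [Fm.subst, Fm.ex_factors, Fm.subst_factors p (Sub.lift_interp h _), env_liftHom]

end

end Forcing

/-! ## Tuples -/

section Tuples

variable {C : Type u} [Category.{v} C] [CartesianMonoidalCategory C] [HasFiniteLimits C]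
  [MonoidalClosed C] [HasSubobjectClassifier C] [HasCountableColimits C]

variable {Γ Δ : Ctx C} {A B T : C}

theorem Var.zero_nil_interp : (Var.zero (Γ := Ctx.nil) (A := A)).interp = 𝟙 A :=
  leftUnitor_inv_snd A

theorem Var.zero_snoc_interp :
    (Var.zero (Γ := Γ.snoc B) (A := A)).interp = snd (Γ.snoc B).obj A :=
  Category.id_comp _

theorem Var.succ_snoc_interp {D : C} (x : Var (Γ.snoc B) D) :
    (Var.succ (B := A) x).interp = fst (Γ.snoc B).obj A ≫ x.interp :=
  Category.id_comp _

/-- The projections of an iterated product. -/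
def proj {n : ℕ} (X : Fin n → C) (j : Fin n) : prodObj X ⟶ X j := (Var.ofFn X j).interp

theorem Var.ofFn_last {n : ℕ} (X : Fin (n + 1) → C) : Var.ofFn X (Fin.last n) = .zero :=
  Fin.lastCases_last (motive := fun j => Var (Ctx.ofFn X) (X j))

theorem Var.ofFn_castSucc {n : ℕ} (X : Fin (n + 1) → C) (i : Fin n) :
    Var.ofFn X i.castSucc = .succ (Var.ofFn (fun i => X i.castSucc) i) :=
  Fin.lastCases_castSucc (motive := fun j => Var (Ctx.ofFn X) (X j)) _

theorem prodObj_ext : ∀ {n : ℕ} {X : Fin n → C} {x y : T ⟶ prodObj X},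
    (∀ j, x ≫ proj X j = y ≫ proj X j) → x = y
  | 0, _, _, _, _ => toUnit_unique _ _
  | n + 1, X, x, y, h => by
    refine (cancel_mono
      ((Ctx.ofFn fun i : Fin n => X i.castSucc).snocIso (X (Fin.last n))).hom).1 ?_
    ext
    · refine prodObj_ext fun j => ?_
      have := h j.castSucc
      rw [proj, Var.ofFn_castSucc] at this
      refine (Category.assoc _ _ _).trans (Eq.trans ?_ (Category.assoc _ _ _).symm)
      exact (Category.assoc _ _ _).trans (this.trans (Category.assoc _ _ _).symm)
    · have := h (Fin.last n)
      rw [proj, Var.ofFn_last] at this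
      exact (Category.assoc _ _ _).trans (this.trans (Category.assoc _ _ _).symm)

theorem Sub.tuple_interp : ∀ {Γ Δ : Ctx C} (σ : Sub Γ Δ) {A : C} (x : Var Γ A),
    σ.tuple.interp ≫ x.interp = (σ A x).interp
  | .snoc .nil _, _, σ, _, .zero => by
    rw [Var.zero_nil_interp]
    exact Category.comp_id _
  | .snoc (.snoc _ _) _, _, σ, _, .zero => by
    rw [Var.zero_snoc_interp]
    exact (congrArg (· ≫ snd _ _) (Tm.interp_pair _ _)).trans (lift_snd _ _)
  | .snoc (.snoc _ _) _, _, σ, _, .succ x => by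
    rw [Var.succ_snoc_interp]
    exact (congrArg (· ≫ fst _ _ ≫ x.interp) (Tm.interp_pair _ _)).trans
      ((lift_fst_assoc _ _ _).trans (Sub.tuple_interp (fun X x => σ X (.succ x)) x))

theorem Sub.ofFn_ofFn : ∀ {n : ℕ} {X : Fin n → C} {Δ : Ctx C} (t : ∀ j, Tm C Δ (X j)) (j : Fin n),
    Sub.ofFn t _ (Var.ofFn X j) = t j
  | n + 1, X, Δ, t, j => by
    refine Fin.lastCases ?_ (fun i => ?_) j
    · rw [Var.ofFn_last]
      rfl
    · rw [Var.ofFn_castSucc]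
      exact Sub.ofFn_ofFn (fun i => t i.castSucc) i

theorem tuple_proj {n : ℕ} {X : Fin n → C} (t : ∀ j, Tm C Γ (X j)) (j : Fin n) :
    (tuple t).interp ≫ proj X j = (t j).interp := by
  rw [tuple, proj, Sub.tuple_interp, Sub.ofFn_ofFn]

theorem Var.proj_interp : ∀ {Γ : Ctx C} {A : C} (x : Var Γ A) {Δ : Ctx C} (w : Tm C Δ Γ.obj),
    (x.proj w).interp = w.interp ≫ x.interp
  | .snoc .nil _, _, .zero, _, w => by
    rw [Var.zero_nil_interp]
    exact (Category.comp_id _).symm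
  | .snoc (.snoc _ _) _, _, .zero, _, w => by
    rw [Var.zero_snoc_interp]
    exact Tm.interp_snd w
  | .snoc (.snoc _ _) _, _, .succ x, _, w => by
    rw [Var.succ_snoc_interp]
    exact (Var.proj_interp x (.fst w)).trans
      ((congrArg (· ≫ x.interp) (Tm.interp_fst w)).trans (Category.assoc _ _ _))

theorem Tm.interp_unpack (t : Tm C Γ B) : t.unpack.interp = t.interp := by
  have h : ∀ A (x : Var Γ A), (x.proj (Δ := .snoc .nil Γ.obj) (.var .zero)).interp =
      𝟙 Γ.obj ≫ x.interp := fun A x => by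
    rw [Var.proj_interp, Tm.interp_var, Var.zero_nil_interp]
    rfl
  exact (Tm.interp_subst (Δ := .snoc .nil Γ.obj) t h).trans (Category.id_comp _)

theorem Tm.interp_inst (t : Tm C (.snoc .nil A) B) (s : Tm C Δ A) :
    (t.inst s).interp = s.interp ≫ t.interp := by
  refine Tm.interp_subst t (u := s.interp) ?_
  rintro _ (_ | ⟨⟨⟩⟩)
  rw [Var.zero_nil_interp]
  exact (Category.comp_id _).symm

end Tuples

/-! ## Semantics of the derived terms and formulas -/

section Derived

variable {C : Type u} [Category.{v} C] [CartesianMonoidalCategory C] [HasFiniteLimits C]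
  [MonoidalClosed C] [HasSubobjectClassifier C] [HasCountableColimits C]

variable {Γ Δ : Ctx C} {A B T : C}

theorem disj_factors : ∀ {T : C} (ρ : T ⟶ Γ.obj) (l : List (Fm C Γ)),
    (disj l).interp.Factors ρ ↔
      Loc fun {W} (g : W ⟶ T) => ∃ p ∈ l, p.interp.Factors (g ≫ ρ)
  | _, _, [] => by simp [disj, Fm.bot_factors]
  | _, _, [p] => by
    simp only [disj, List.mem_singleton, exists_eq_left]
    exact ⟨fun h => .of_id (by simpa using h), fun h => h.factors fun _ hg => hg⟩
  | T, ρ, p :: q :: l => by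
    rw [disj, Fm.or_factors]
    constructor
    · refine fun h => h.bind fun {W} g hg => ?_
      rcases hg with hg | hg
      · exact .of_id ⟨p, by simp, by simpa using hg⟩
      · refine ((disj_factors (g ≫ ρ) (q :: l)).1 hg).mono ?_
        rintro V k ⟨r, hr, hk⟩
        exact ⟨r, List.mem_cons_of_mem _ hr, by simpa using hk⟩
    · refine fun h => h.mono ?_
      rintro W g ⟨r, hr, hg⟩
      rcases List.mem_cons.1 hr with rfl | hr
      · exact .inl hg
      · exact .inr ((disj_factors (g ≫ ρ) (q :: l)).2 (.of_id ⟨r, hr, by simpa using hg⟩))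

theorem conj_factors (ρ : T ⟶ Γ.obj) : ∀ l : List (Fm C Γ),
    (conj l).interp.Factors ρ ↔ ∀ p ∈ l, p.interp.Factors ρ
  | [] => by simp [conj, Fm.top_factors]
  | [p] => by simp [conj]
  | p :: q :: l => by
    rw [conj, Fm.and_factors, conj_factors ρ (q :: l), List.forall_mem_cons (l := q :: l)]

theorem mem_sing (t : Tm C Γ A) (ρ : T ⟶ Γ.obj) (a : T ⟶ A) :
    Mem a (ρ ≫ (sing t).interp) ↔ a = ρ ≫ t.interp := by
  rw [sing, Tm.mem_setOf, Fm.eq_factors, Tm.interp_var, env_zero, Tm.env_wk]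

theorem mem_empty (ρ : T ⟶ Γ.obj) (a : T ⟶ A) :
    Mem a (ρ ≫ (empty A).interp) ↔ Loc fun {W} (_ : W ⟶ T) => False := by
  rw [empty, Tm.mem_setOf, Fm.bot_factors]

theorem mem_union (S S' : Tm C Γ (Pow A)) (ρ : T ⟶ Γ.obj) (a : T ⟶ A) :
    Mem a (ρ ≫ (union S S').interp) ↔ Loc fun {W} (g : W ⟶ T) =>
      Mem (g ≫ a) (g ≫ ρ ≫ S.interp) ∨ Mem (g ≫ a) (g ≫ ρ ≫ S'.interp) := by
  rw [union, Tm.mem_setOf, Fm.or_factors]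
  simp only [Fm.mem_factors, Tm.interp_var, comp_env, env_zero, Tm.env_wk, Category.assoc]

theorem mem_unions : ∀ {T : C} (ρ : T ⟶ Γ.obj) (a : T ⟶ A) (l : List (Tm C Γ (Pow A))),
    Mem a (ρ ≫ (unions l).interp) ↔
      Loc fun {W} (g : W ⟶ T) => ∃ S ∈ l, Mem (g ≫ a) (g ≫ ρ ≫ S.interp)
  | _, _, _, [] => by simp [unions, mem_empty]
  | _, _, _, [S] => by
    simp only [unions, List.mem_singleton, exists_eq_left]
    exact ⟨fun h => .of_id (by simpa using h), fun h => h.mem fun _ hg => hg⟩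
  | T, ρ, a, S :: S' :: l => by
    rw [unions, mem_union]
    constructor
    · refine fun h => h.bind fun {W} g hg => ?_
      rcases hg with hg | hg
      · exact .of_id ⟨S, by simp, by simpa using hg⟩
      · rw [← Category.assoc] at hg
        refine ((mem_unions (g ≫ ρ) (g ≫ a) (S' :: l)).1 hg).mono ?_
        rintro V k ⟨r, hr, hk⟩
        exact ⟨r, List.mem_cons_of_mem _ hr, by simpa using hk⟩
    · refine fun h => h.mono ?_
      rintro W g ⟨r, hr, hg⟩
      rcases List.mem_cons.1 hr with rfl | hr
      · exact .inl hg
      · refine .inr ?_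
        rw [← Category.assoc]
        exact (mem_unions (g ≫ ρ) (g ≫ a) (S' :: l)).2 (.of_id ⟨r, hr, by simpa using hg⟩)

theorem mem_image (f : A ⟶ B) (S : Tm C Γ (Pow A)) (ρ : T ⟶ Γ.obj) (b : T ⟶ B) :
    Mem b (ρ ≫ (image f S).interp) ↔ Loc fun {W} (g : W ⟶ T) =>
      ∃ a : W ⟶ A, Mem a (g ≫ ρ ≫ S.interp) ∧ g ≫ b = a ≫ f := by
  rw [image, Tm.mem_setOf, Fm.ex_factors]
  simp only [Fm.and_factors, Fm.mem_factors, Fm.eq_factors, Tm.interp_app, Tm.interp_var,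
    ← Category.assoc _ _ f, env_zero, env_succ, comp_env, Tm.env_wk, Category.assoc]

/-- The extension of a generalised element of the object of `Γ` by `n` elements of `A`. -/
def envN (ρ : T ⟶ Γ.obj) : ∀ {n : ℕ}, (Fin n → (T ⟶ A)) → (T ⟶ (Γ.snocN A n).obj)
  | 0, _ => ρ
  | _ + 1, a => env (envN ρ fun i => a i.castSucc) (a (Fin.last _))

theorem comp_envN {W : C} (g : W ⟶ T) (ρ : T ⟶ Γ.obj) : ∀ {n : ℕ} (a : Fin n → (T ⟶ A)),
    g ≫ envN ρ a = envN (g ≫ ρ) fun i => g ≫ a i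
  | 0, _ => rfl
  | _ + 1, a => (comp_env g _ _).trans
    (congrArg (fun σ => env σ _) (comp_envN g ρ fun i => a i.castSucc))

theorem envN_wkN (t : Tm C Γ B) (ρ : T ⟶ Γ.obj) : ∀ {n : ℕ} (a : Fin n → (T ⟶ A)),
    envN ρ a ≫ (t.wkN n).interp = ρ ≫ t.interp
  | 0, _ => rfl
  | _ + 1, a => (Tm.env_wk _ _ _).trans (envN_wkN t ρ fun i => a i.castSucc)

theorem Var.snocN_last (n : ℕ) :
    Var.snocN (Γ := Γ) (A := A) (n + 1) (Fin.last n) = .zero :=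
  Fin.lastCases_last (motive := fun _ => Var (Γ.snocN A (n + 1)) A)

theorem Var.snocN_castSucc (n : ℕ) (i : Fin n) :
    Var.snocN (Γ := Γ) (A := A) (n + 1) i.castSucc = .succ (Var.snocN n i) :=
  Fin.lastCases_castSucc (motive := fun _ => Var (Γ.snocN A (n + 1)) A) _

theorem envN_snocN (ρ : T ⟶ Γ.obj) : ∀ {n : ℕ} (a : Fin n → (T ⟶ A)) (i : Fin n),
    envN ρ a ≫ (Var.snocN n i).interp = a i
  | n + 1, a, i => by
    refine Fin.lastCases ?_ (fun i => ?_) i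
    · rw [Var.snocN_last]
      exact env_zero _ _
    · rw [Var.snocN_castSucc]
      exact (env_succ _ _ _).trans (envN_snocN ρ (fun i => a i.castSucc) i)

theorem exN_factors (ρ : T ⟶ Γ.obj) : ∀ {n : ℕ} (p : Fm C (Γ.snocN A n)),
    (exN n p).interp.Factors ρ ↔ Loc fun {W} (g : W ⟶ T) =>
      ∃ a : Fin n → (W ⟶ A), p.interp.Factors (envN (g ≫ ρ) a)
  | 0, p => by
    constructor
    · exact fun h => .of_id ⟨Fin.elim0, by rw [Category.id_comp]; exact h⟩
    · refine fun h => h.factors ?_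
      rintro W g ⟨_, hg⟩
      exact hg
  | n + 1, p => by
    rw [exN, exN_factors ρ]
    constructor
    · refine fun h => h.bind ?_
      rintro W g ⟨a, ha⟩
      refine ((Fm.ex_factors _ _).1 ha).mono ?_
      rintro V k ⟨b, hb⟩
      refine ⟨Fin.snoc (α := fun _ => V ⟶ A) (fun i => k ≫ a i) b, ?_⟩
      rw [comp_envN, ← Category.assoc] at hb
      simp only [envN, Fin.snoc_castSucc, Fin.snoc_last]
      exact hb
    · refine fun h => h.mono ?_
      rintro W g ⟨a, ha⟩
      refine ⟨fun i => a i.castSucc, (Fm.ex_factors _ _).2 (.of_id ⟨a (Fin.last n), ?_⟩)⟩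
      rw [Category.id_comp]
      exact ha

end Derived

/-! ## Equivalence classes -/

section Classes

variable {C : Type u} [Category.{v} C] [CartesianMonoidalCategory C] [HasFiniteLimits C]
  [MonoidalClosed C] [HasSubobjectClassifier C] [HasCountableColimits C]

variable {Γ Δ : Ctx C} {A B T W : C}

/-- Two generalised elements are the values, in either order, of the two morphisms `f false` and
`f true` at a common argument. -/
def Step (f : Bool → (A ⟶ B)) (b b' : T ⟶ B) : Prop :=
  ∃ (c : Bool) (a : T ⟶ A), b = a ≫ f c ∧ b' = a ≫ f (!c)

theorem Step.symm {f : Bool → (A ⟶ B)} {b b' : T ⟶ B} : Step f b b' → Step f b' b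
  | ⟨c, a, h, h'⟩ => ⟨!c, a, h', by rwa [Bool.not_not]⟩

theorem Step.comp {f : Bool → (A ⟶ B)} {b b' : T ⟶ B} (g : W ⟶ T) :
    Step f b b' → Step f (g ≫ b) (g ≫ b')
  | ⟨c, a, h, h'⟩ => ⟨c, g ≫ a, by rw [h, Category.assoc], by rw [h', Category.assoc]⟩

/-- The zigzag from `b` to `b'` through the values at `a`, in the directions `α`. -/
def IsZigzag (f : Bool → (A ⟶ B)) (b b' : T ⟶ B) {k : ℕ} (α : Fin (k + 1) → Bool)
    (a : Fin (k + 1) → (T ⟶ A)) : Prop :=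
  b = a 0 ≫ f (α 0) ∧
    (∀ i : Fin k, a i.castSucc ≫ f (!α i.castSucc) = a i.succ ≫ f (α i.succ)) ∧
    a (Fin.last k) ≫ f (!α (Fin.last k)) = b'

theorem reflTransGen_step_iff (f : Bool → (A ⟶ B)) (b b' : T ⟶ B) :
    Relation.ReflTransGen (Step f) b b' ↔
      b = b' ∨ ∃ (k : ℕ) (α : Fin (k + 1) → Bool) (a : Fin (k + 1) → (T ⟶ A)),
        IsZigzag f b b' α a := by
  constructor
  · intro h
    induction h using Relation.ReflTransGen.head_induction_on with
    | refl => exact .inl rfl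
    | @head x y hxy _ ih =>
      obtain ⟨c, a, rfl, rfl⟩ := hxy
      refine .inr ?_
      rcases ih with ih | ⟨k, α, a', h₀, h₁, h₂⟩
      · exact ⟨0, fun _ => c, fun _ => a, rfl, fun i => i.elim0, ih⟩
      · refine ⟨k + 1, Fin.cons c α, Fin.cons (α := fun _ => T ⟶ A) a a', by simp,
          fun i => ?_, ?_⟩
        · induction i using Fin.cases with
          | zero => simpa using h₀
          | succ i =>
            rw [← Fin.succ_castSucc]
            simpa only [Fin.cons_succ] using h₁ i
        · rw [← Fin.succ_last]
          simpa only [Fin.cons_succ] using h₂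
  · rintro (rfl | ⟨k, α, a, rfl, h₁, rfl⟩)
    · exact .refl
    · suffices ∀ i : Fin (k + 1),
          Relation.ReflTransGen (Step f) (a 0 ≫ f (α 0)) (a i ≫ f (!α i)) from this _
      intro i
      induction i using Fin.induction with
      | zero => exact .single ⟨_, _, rfl, rfl⟩
      | succ i ih => exact ih.tail (h₁ i ▸ ⟨_, _, rfl, rfl⟩)

theorem inst_snocN_eval {n : ℕ} (t : Tm C (.snoc .nil A) B) (ρ : T ⟶ Γ.obj)
    (a : Fin n → (T ⟶ A)) (i : Fin n) :
    envN ρ a ≫ (t.inst (Tm.var (Var.snocN n i))).interp = a i ≫ t.interp := by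
  rw [Tm.interp_inst, Tm.interp_var]
  exact (Category.assoc _ _ _).symm.trans (congrArg (· ≫ t.interp) (envN_snocN ρ a i))

theorem zigzag_factors (t : Bool → Tm C (.snoc .nil A) B) (b₁ b₂ : Tm C Γ B) (k : ℕ)
    (α : Fin (k + 1) → Bool) (ρ : T ⟶ Γ.obj) :
    (zigzag t b₁ b₂ k α).interp.Factors ρ ↔ Loc fun {W} (g : W ⟶ T) =>
      ∃ a : Fin (k + 1) → (W ⟶ A), IsZigzag (fun c => (t c).interp)
        (g ≫ ρ ≫ b₁.interp) (g ≫ ρ ≫ b₂.interp) α a := by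
  have key : ∀ {W : C} (g : W ⟶ T) (a : Fin (k + 1) → (W ⟶ A)), _ ↔ _ := fun g a =>
    conj_factors (envN (g ≫ ρ) a) (
    [.eq (b₁.wkN (k + 1)) ((t (α 0)).inst (.var (Var.snocN (k + 1) 0)))] ++
    List.ofFn (fun i : Fin k =>
      Fm.eq ((t (!α i.castSucc)).inst (.var (Var.snocN (k + 1) i.castSucc)))
        ((t (α i.succ)).inst (.var (Var.snocN (k + 1) i.succ)))) ++
    [.eq ((t (!α (Fin.last k))).inst (.var (Var.snocN (k + 1) (Fin.last k))))
      (b₂.wkN (k + 1))])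
  rw [zigzag, exN_factors]
  simp only [key, List.forall_mem_append, List.forall_mem_singleton, List.forall_mem_ofFn_iff,
    Fm.eq_factors, envN_wkN, inst_snocN_eval, IsZigzag, Category.assoc, and_assoc]
  rfl

theorem rel_factors (t : Bool → Tm C (.snoc .nil A) B) (b₁ b₂ : Tm C Γ B) (ρ : T ⟶ Γ.obj) :
    (Fm.or (.eq b₁ b₂) (.iSup fun k =>
      disj ((Finset.univ : Finset (Fin (k + 1) → Bool)).toList.map
        (zigzag t b₁ b₂ k)))).interp.Factors ρ ↔ Loc fun {W} (g : W ⟶ T) =>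
      Relation.ReflTransGen (Step fun c => (t c).interp)
        (g ≫ ρ ≫ b₁.interp) (g ≫ ρ ≫ b₂.interp) := by
  have hdisj : ∀ (k : ℕ) {W : C} (σ : W ⟶ Γ.obj),
      (disj ((Finset.univ : Finset (Fin (k + 1) → Bool)).toList.map
        (zigzag t b₁ b₂ k))).interp.Factors σ ↔ Loc fun {V} (g : V ⟶ W) =>
          ∃ α, (zigzag t b₁ b₂ k α).interp.Factors (g ≫ σ) := fun k W σ => by
    rw [disj_factors]
    simp
  simp only [Fm.or_factors, Fm.eq_factors, Fm.iSup_factors, reflTransGen_step_iff]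
  constructor
  · refine fun h => h.bind fun g hg => ?_
    rcases hg with hg | hg
    · exact .of_id (.inl (by simpa using hg))
    · refine hg.bind ?_
      rintro W k ⟨n, hn⟩
      refine ((hdisj n _).1 hn).bind ?_
      rintro V l ⟨α, hα⟩
      refine ((zigzag_factors t b₁ b₂ n α _).1 hα).mono ?_
      rintro V' l' ⟨a, ha⟩
      exact .inr ⟨n, α, a, by simpa using ha⟩
  · refine fun h => h.mono fun {W} g hg => ?_
    rcases hg with hg | ⟨n, α, a, ha⟩
    · exact .inl (by simpa using hg)
    · refine .inr (.of_id ⟨n, (hdisj n _).2 (.of_id ⟨α, ?_⟩)⟩)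
      exact (zigzag_factors t b₁ b₂ n α _).2 (.of_id ⟨a, by simpa using ha⟩)

theorem mem_relTm (t₀ t₁ : Tm C (.snoc .nil A) B) (ρ : T ⟶ Γ.obj) (b b' : T ⟶ B) :
    Mem (lift b b') (ρ ≫ (relTm t₀ t₁).interp) ↔ Loc fun {W} (g : W ⟶ T) =>
      Relation.ReflTransGen (Step fun c => (cond c t₁ t₀).interp) (g ≫ b) (g ≫ b') := by
  rw [relTm, Tm.mem_setOf, Fm.ex_factors]
  simp only [Fm.ex_factors, Fm.and_factors, rel_factors, Fm.eq_factors, Tm.interp_pair,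
    Tm.interp_var, comp_env, env_zero, env_succ, comp_lift]
  constructor
  · refine fun h => h.bind ?_
    rintro W g ⟨b₁, h⟩
    refine h.bind ?_
    rintro V k ⟨b₂, h₁, h₂⟩
    refine h₂.mono fun {V'} l hl => ?_
    have e₁ := h₁ =≫ fst _ _
    have e₂ := h₁ =≫ snd _ _
    simp only [lift_fst, lift_snd] at e₁ e₂
    rw [← e₁, ← e₂] at hl
    simpa using hl
  · refine fun h => h.mono fun {W} g hg => ?_
    exact ⟨g ≫ b, .of_id ⟨g ≫ b', by simp, .of_id (by simpa using hg)⟩⟩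

theorem mem_classTm (t₀ t₁ : Tm C (.snoc .nil A) B) (b : Tm C Γ B) (ρ : T ⟶ Γ.obj)
    (b' : T ⟶ B) :
    Mem b' (ρ ≫ (classTm t₀ t₁ b).interp) ↔ Loc fun {W} (g : W ⟶ T) =>
      Relation.ReflTransGen (Step fun c => (cond c t₁ t₀).interp)
        (g ≫ ρ ≫ b.interp) (g ≫ b') := by
  rw [classTm, Tm.mem_setOf, Fm.mem_factors, Tm.interp_pair, comp_lift, mem_relTm, Tm.interp_var,
    env_zero, Tm.env_wk]

end Classes

/-! ## Colimits of finite diagrams -/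

section Diagrams

variable {C : Type u} [Category.{v} C] [CartesianMonoidalCategory C] [HasFiniteLimits C]
  [MonoidalClosed C] [HasSubobjectClassifier C] [HasCountableColimits C]

variable {Γ : Ctx C} {T W : C} {n : ℕ} (A : Fin n → C)

theorem mem_inj_self (j : Fin n) (t : Tm C Γ (A j)) (ρ : T ⟶ Γ.obj) (a : T ⟶ A j) :
    Mem a ((ρ ≫ (inj A j t).interp) ≫ proj _ j) ↔ a = ρ ≫ t.interp := by
  rw [Category.assoc, inj, tuple_proj, dif_pos rfl, mem_sing]

theorem mem_inj_of_ne {j k : Fin n} (hk : k ≠ j) (t : Tm C Γ (A j)) (ρ : T ⟶ Γ.obj)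
    (a : T ⟶ A k) :
    Mem a ((ρ ≫ (inj A j t).interp) ≫ proj _ k) ↔ Loc fun {W} (_ : W ⟶ T) => False := by
  rw [Category.assoc, inj, tuple_proj, dif_neg hk, mem_empty]

/-- The generalised elements of the `k`-th component of `⟨∅, …, {a}, …, ∅⟩`. -/
theorem mem_inj (j k : Fin n) (t : Tm C Γ (A j)) (ρ : T ⟶ Γ.obj) (a : T ⟶ A k) :
    Mem a ((ρ ≫ (inj A j t).interp) ≫ proj _ k) ↔ Loc fun {W} (g : W ⟶ T) =>
      (⟨k, g ≫ a⟩ : Σ j, W ⟶ A j) = ⟨j, g ≫ ρ ≫ t.interp⟩ := by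
  rcases eq_or_ne k j with rfl | hk
  · rw [mem_inj_self]
    simp only [Sigma.mk.injEq, heq_eq_eq, true_and]
    exact ⟨fun h => .of_id (by rw [h]), fun h => h.eq fun _ hg => hg⟩
  · rw [mem_inj_of_ne A hk]
    simp [hk]

theorem mem_injHom (j k : Fin n) (a : T ⟶ A j) (b : T ⟶ A k) :
    Mem b ((a ≫ injHom A j) ≫ proj _ k) ↔ Loc fun {W} (g : W ⟶ T) =>
      (⟨k, g ≫ b⟩ : Σ j, W ⟶ A j) = ⟨j, g ≫ a⟩ := by
  have := mem_inj A j k (Γ := .snoc .nil (A j)) (.var .zero) a b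
  rw [Tm.interp_var, Var.zero_nil_interp] at this
  refine this.trans (iff_of_eq ?_)
  have e : a ≫ 𝟙 (A j) = a := Category.comp_id a
  exact congrArg (fun a' : T ⟶ A j => Loc fun {W} (g : W ⟶ T) =>
      (⟨k, g ≫ b⟩ : Σ j, W ⟶ A j) = ⟨j, g ≫ a'⟩) e

theorem prodPow_ext {x y : T ⟶ prodObj fun j => Pow (A j)}
    (h : ∀ {W : C} (g : W ⟶ T) (j : Fin n) (a : W ⟶ A j),
      Mem a ((g ≫ x) ≫ proj _ j) ↔ Mem a ((g ≫ y) ≫ proj _ j)) : x = y :=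
  prodObj_ext fun j => pow_ext fun g a => by simpa only [Category.assoc] using h g j a

theorem inj_eval (j : Fin n) (t : Tm C Γ (A j)) (ρ : T ⟶ Γ.obj) :
    ρ ≫ (inj A j t).interp = (ρ ≫ t.interp) ≫ injHom A j :=
  prodPow_ext A fun g k a => by
    rw [← Category.assoc, ← Category.assoc, mem_inj, mem_injHom, Category.assoc]

theorem coprodFm_factors (z : Tm C Γ (prodObj fun j => Pow (A j))) (ρ : T ⟶ Γ.obj) :
    (coprodFm A z).interp.Factors ρ ↔ Loc fun {W} (g : W ⟶ T) =>
      ∃ (j : Fin n) (a : W ⟶ A j), g ≫ ρ ≫ z.interp = a ≫ injHom A j := by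
  rw [coprodFm, disj_factors]
  simp only [List.mem_map, List.mem_finRange, true_and, exists_exists_eq_and, Fm.ex_factors,
    Fm.eq_factors, Tm.env_wk, inj_eval, Tm.interp_var, env_zero, Category.assoc]
  constructor
  · refine fun h => h.bind ?_
    rintro W g ⟨j, h⟩
    refine h.mono ?_
    rintro V k ⟨a, e⟩
    exact ⟨j, a, (Category.assoc _ _ _).trans e⟩
  · refine fun h => h.mono ?_
    rintro W g ⟨j, a, e⟩
    exact ⟨j, .of_id ⟨a, by rw [Category.id_comp]; exact e⟩⟩

theorem coprodSub_factors_iff (z : T ⟶ prodObj fun j => Pow (A j)) :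
    (coprodSub A).Factors z ↔ Loc fun {W} (g : W ⟶ T) =>
      ∃ (j : Fin n) (a : W ⟶ A j), g ≫ z = a ≫ injHom A j := by
  have := coprodFm_factors A (Γ := .snoc .nil _) (.var .zero) z
  rw [Tm.interp_var, Var.zero_nil_interp] at this
  refine this.trans (iff_of_eq ?_)
  exact congrArg (fun z' : T ⟶ prodObj fun j => Pow (A j) => Loc fun {W} (g : W ⟶ T) =>
      ∃ (j : Fin n) (a : W ⟶ A j), g ≫ z' = a ≫ injHom A j) (Category.comp_id z)

theorem coprodSub_factors_injHom (j : Fin n) : (coprodSub A).Factors (injHom A j) :=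
  (coprodSub_factors_iff A _).2 (.of_id ⟨j, 𝟙 _, rfl⟩)

/-- The injections of the coproduct described by the internal logic. -/
def coprodι (j : Fin n) : A j ⟶ (coprodSub A : C) :=
  (coprodSub A).factorThru _ (coprodSub_factors_injHom A j)

@[simp]
theorem coprodι_arrow (j : Fin n) : coprodι A j ≫ (coprodSub A).arrow = injHom A j :=
  Subobject.factorThru_arrow _ _ _

theorem coprodι_cover : Loc fun {W} (g : W ⟶ (coprodSub A : C)) =>
    ∃ (j : Fin n) (a : W ⟶ A j), a ≫ coprodι A j = g := by
  refine ((coprodSub_factors_iff A _).1 (coprodSub A).factors_self).mono ?_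
  rintro W g ⟨j, a, e⟩
  exact ⟨j, a, by rw [← cancel_mono (coprodSub A).arrow, Category.assoc, coprodι_arrow, e]⟩

theorem coprodSub_hom_ext {X : C} {x y : (coprodSub A : C) ⟶ X}
    (h : ∀ j, coprodι A j ≫ x = coprodι A j ≫ y) : x = y := by
  refine (coprodι_cover A).eq ?_
  rintro W g ⟨j, a, rfl⟩
  simp only [Category.assoc, h]

variable {A}

/-- All generalised elements of the components of `b` are mapped to `c` by the given family of
morphisms. -/
def AllEq {X : C} (h : ∀ j, A j ⟶ X) (b : T ⟶ prodObj fun j => Pow (A j)) (c : T ⟶ X) : Prop :=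
  ∀ (W : C) (g : W ⟶ T) (j : Fin n) (a : W ⟶ A j), Mem a ((g ≫ b) ≫ proj _ j) →
    a ≫ h j = g ≫ c

theorem AllEq.injHom {X : C} (h : ∀ j, A j ⟶ X) {j : Fin n} (a : T ⟶ A j) :
    AllEq h (a ≫ injHom A j) (a ≫ h j) := by
  intro W g k b hb
  rw [← Category.assoc, mem_injHom] at hb
  refine hb.eq fun {V} l hl => ?_
  simpa using congrArg (fun e : Σ j, V ⟶ A j => e.2 ≫ h e.1) hl

theorem AllEq.eq_of_injHom {X : C} {h : ∀ j, A j ⟶ X} {j : Fin n} {a : T ⟶ A j} {c : T ⟶ X}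
    (H : AllEq h (a ≫ InternalLogic.injHom A j) c) : a ≫ h j = c := by
  simpa using H _ (𝟙 T) j a (by
    rw [Category.id_comp, mem_injHom]
    exact .of_id rfl)

theorem isColimit_coprodι : Nonempty (IsColimit (Cofan.mk _ (coprodι A))) := by
  have key : ∀ (X : C) (h : ∀ j, A j ⟶ X), ∃! u, ∀ j, coprodι A j ≫ u = h j := fun X h =>
    existsUnique_desc _ (coprodι_cover A) h fun j k a b e => by
      have e' := e =≫ (coprodSub A).arrow
      simp only [Category.assoc, coprodι_arrow] at e'
      exact AllEq.eq_of_injHom (e' ▸ AllEq.injHom h b)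
  exact ⟨Cofan.IsColimit.mk _ (fun s => (key _ s.inj).choose)
    (fun s => (key _ s.inj).choose_spec.1) (fun s w hw => (key _ s.inj).choose_spec.2 w hw)⟩

variable {m : ℕ} {s r t : Fin m → Fin n}

/-- A morphism between products of power objects computes, in each component, the union of the
images of the given subsets under the given morphisms. -/
def IsImageMap (φ : ∀ i, A (s i) ⟶ A (r i))
    (M : (prodObj fun i => Pow (A (s i))) ⟶ prodObj fun j => Pow (A j)) : Prop :=
  ∀ (T : C) (z : T ⟶ prodObj fun i => Pow (A (s i))) (j : Fin n) (a : T ⟶ A j),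
    Mem a ((z ≫ M) ≫ proj _ j) ↔ Loc fun {W} (g : W ⟶ T) =>
      ∃ (i : Fin m) (b : W ⟶ A (s i)), Mem b ((g ≫ z) ≫ proj _ i) ∧
        (⟨j, g ≫ a⟩ : Σ j, W ⟶ A j) = ⟨r i, b ≫ φ i⟩

theorem mem_collect (Z : ∀ i, Tm C Γ (Pow (A (r i)))) (ρ : T ⟶ Γ.obj) (j : Fin n)
    (a : T ⟶ A j) :
    Mem a ((ρ ≫ (collect A r Z).interp) ≫ proj _ j) ↔ Loc fun {W} (g : W ⟶ T) =>
      ∃ (i : Fin m) (b : W ⟶ A (r i)), Mem b (g ≫ ρ ≫ (Z i).interp) ∧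
        (⟨j, g ≫ a⟩ : Σ j, W ⟶ A j) = ⟨r i, b⟩ := by
  rw [Category.assoc, collect, tuple_proj, mem_unions]
  simp only [List.mem_filterMap, List.mem_finRange, true_and]
  constructor
  · refine fun h => h.mono ?_
    rintro W g ⟨S, ⟨i, hi⟩, hS⟩
    split_ifs at hi with hij
    subst hij
    obtain rfl := Option.some.inj hi
    exact ⟨i, g ≫ a, hS, rfl⟩
  · refine fun h => h.mono ?_
    rintro W g ⟨i, b, hb, e⟩
    obtain rfl : j = r i := congrArg Sigma.fst e
    obtain rfl := eq_of_heq (Sigma.mk.inj e).2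
    exact ⟨Z i, ⟨i, by simp⟩, hb⟩

theorem domVar_interp (i : Fin m) : (domVar A s i).interp = proj (fun i => Pow (A (s i))) i := by
  rw [domVar, Tm.interp_var, proj]

theorem isImageMap_map₀ : IsImageMap (fun i => 𝟙 (A (s i))) (map₀ A s) := by
  intro T z j a
  rw [map₀, term₀, mem_collect]
  simp only [domVar_interp, Category.comp_id, Category.assoc]

theorem isImageMap_map₁ (f : ∀ i, A (s i) ⟶ A (t i)) : IsImageMap f (map₁ A f) := by
  intro T z j a
  rw [map₁, term₁, mem_collect]
  simp only [← Category.assoc _ z, mem_image, domVar_interp]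
  constructor
  · refine fun h => h.bind ?_
    rintro W g ⟨i, b, hb, e⟩
    refine hb.mono ?_
    rintro V k ⟨a', ha', e'⟩
    refine ⟨i, a', by simpa using ha', ?_⟩
    rw [← e']
    simpa using congrArg (fun x : Σ j, W ⟶ A j => (⟨x.1, k ≫ x.2⟩ : Σ j, V ⟶ A j)) e
  · refine fun h => h.mono ?_
    rintro W g ⟨i, b, hb, e⟩
    exact ⟨i, b ≫ f i, .of_id ⟨b, by simpa using hb, by simp⟩, e⟩

namespace IsImageMap

variable {φ : ∀ i, A (s i) ⟶ A (r i)}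
  {M : (prodObj fun i => Pow (A (s i))) ⟶ prodObj fun j => Pow (A j)}

theorem injHom_comp (hM : IsImageMap φ M) (i : Fin m) :
    injHom (fun i => A (s i)) i ≫ M = φ i ≫ injHom A (r i) := by
  refine prodPow_ext A fun {W} g j a => ?_
  rw [← Category.assoc, ← Category.assoc, hM, mem_injHom]
  constructor
  · refine fun h => h.bind ?_
    rintro V k ⟨i', b, hb, e⟩
    rw [← Category.assoc, mem_injHom (fun i => A (s i))] at hb
    refine hb.mono fun {V'} l hl => ?_
    have e' := congrArg (fun x : Σ j, V ⟶ A j => (⟨x.1, l ≫ x.2⟩ : Σ j, V' ⟶ A j)) e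
    have hl' := congrArg (fun x : Σ i, V' ⟶ A (s i) =>
      (⟨r x.1, x.2 ≫ φ x.1⟩ : Σ j, V' ⟶ A j)) hl
    simpa using e'.trans ((by simp : _ = _).trans hl')
  · refine fun h => h.mono fun {V} k hk => ?_
    refine ⟨i, k ≫ g, ?_, by simpa using hk⟩
    rw [← Category.assoc, mem_injHom (fun i => A (s i))]
    exact .of_id rfl

theorem factors (hM : IsImageMap φ M) :
    (coprodSub A).Factors ((coprodSub fun i => A (s i)).arrow ≫ M) := by
  refine (coprodι_cover fun i => A (s i)).factors ?_
  rintro W g ⟨i, a, rfl⟩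
  rw [Category.assoc, ← Category.assoc (coprodι _ i), coprodι_arrow, hM.injHom_comp]
  exact Subobject.factors_of_factors_right _
    (Subobject.factors_of_factors_right _ (coprodSub_factors_injHom A _))

theorem allEq_iff (hM : IsImageMap φ M) {X : C} (h : ∀ j, A j ⟶ X)
    (z : T ⟶ prodObj fun i => Pow (A (s i))) (c : T ⟶ X) :
    AllEq h (z ≫ M) c ↔ AllEq (fun i => φ i ≫ h (r i)) z c := by
  constructor
  · intro H W g i b hb
    have := H _ g (r i) (b ≫ φ i) (by
      rw [← Category.assoc, hM]
      refine .of_id ⟨i, b, ?_, by simp⟩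
      simpa using hb)
    simpa using this
  · intro H W g j a ha
    rw [← Category.assoc, hM] at ha
    refine ha.eq ?_
    rintro V k ⟨i, b, hb, e⟩
    have e' := congrArg (fun x : Σ j, V ⟶ A j => x.2 ≫ h x.1) e
    have := H _ (k ≫ g) i b (by simpa using hb)
    simp only [Category.assoc] at e' this
    rw [e', this]

end IsImageMap

variable (f : ∀ i, A (s i) ⟶ A (t i))

theorem AllEq.of_step {X : C} {h : ∀ j, A j ⟶ X} (hf : ∀ i, f i ≫ h (t i) = h (s i))
    {b b' : T ⟶ prodObj fun j => Pow (A j)} {c : T ⟶ X}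
    (hb : Step (fun c => cond c (map₁ A f) (map₀ A s)) b b') (H : AllEq h b c) :
    AllEq h b' c := by
  have key : ∀ (d : Bool) (z : T ⟶ prodObj fun i => Pow (A (s i))),
      AllEq h (z ≫ cond d (map₁ A f) (map₀ A s)) c ↔ AllEq (fun i => h (s i)) z c := by
    rintro (_ | _) z
    · rw [cond_false, isImageMap_map₀.allEq_iff]
      simp only [Category.id_comp]
    · rw [cond_true, (isImageMap_map₁ f).allEq_iff]
      simp only [hf]
  obtain ⟨d, z, rfl, rfl⟩ := hb
  exact (key (!d) z).2 ((key d z).1 H)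

theorem AllEq.of_reflTransGen {X : C} {h : ∀ j, A j ⟶ X} (hf : ∀ i, f i ≫ h (t i) = h (s i))
    {b b' : T ⟶ prodObj fun j => Pow (A j)} {c : T ⟶ X}
    (hb : Relation.ReflTransGen (Step fun c => cond c (map₁ A f) (map₀ A s)) b b')
    (H : AllEq h b c) : AllEq h b' c := by
  induction hb with
  | refl => exact H
  | tail _ hs ih => exact ih.of_step f hf hs

theorem mem_classTm_unpack (b : Tm C Γ (prodObj fun j => Pow (A j))) (ρ : T ⟶ Γ.obj)
    (b' : T ⟶ prodObj fun j => Pow (A j)) :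
    Mem b' (ρ ≫ (classTm (term₀ A s).unpack (term₁ A f).unpack b).interp) ↔
      Loc fun {W} (g : W ⟶ T) =>
        Relation.ReflTransGen (Step fun c => cond c (map₁ A f) (map₀ A s))
          (g ≫ ρ ≫ b.interp) (g ≫ b') := by
  rw [mem_classTm]
  have e : (fun c => (cond c (term₁ A f).unpack (term₀ A s).unpack).interp) =
      fun c => cond c (map₁ A f) (map₀ A s) := by
    funext c
    cases c
    · exact Tm.interp_unpack _
    · exact Tm.interp_unpack _
  rw [e]
  rfl

theorem mem_classMap (b b' : T ⟶ prodObj fun j => Pow (A j)) :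
    Mem b' (b ≫ classMap A f) ↔ Loc fun {W} (g : W ⟶ T) =>
      Relation.ReflTransGen (Step fun c => cond c (map₁ A f) (map₀ A s)) (g ≫ b) (g ≫ b') := by
  have := mem_classTm_unpack f (Γ := .snoc .nil _) (.var .zero) b b'
  rw [Tm.interp_var, Var.zero_nil_interp] at this
  refine this.trans (iff_of_eq ?_)
  exact congrArg (fun b₁ : T ⟶ prodObj fun j => Pow (A j) => Loc fun {W} (g : W ⟶ T) =>
    Relation.ReflTransGen (Step fun c => cond c (map₁ A f) (map₀ A s)) (g ≫ b₁) (g ≫ b'))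
    (Category.comp_id b)

theorem classTm_eval (b : Tm C Γ (prodObj fun j => Pow (A j))) (ρ : T ⟶ Γ.obj) :
    ρ ≫ (classTm (term₀ A s).unpack (term₁ A f).unpack b).interp =
      (ρ ≫ b.interp) ≫ classMap A f :=
  pow_ext fun g b' => by
    rw [← Category.assoc, mem_classTm_unpack, ← Category.assoc, mem_classMap, Category.assoc]

theorem comp_classMap_eq_of_step {b b' : T ⟶ prodObj fun j => Pow (A j)}
    (h : Step (fun c => cond c (map₁ A f) (map₀ A s)) b b') :
    b ≫ classMap A f = b' ≫ classMap A f := by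
  refine pow_ext fun g x => ?_
  rw [← Category.assoc, ← Category.assoc, mem_classMap, mem_classMap]
  exact ⟨fun H => H.mono fun k hk => .head ((h.comp g).comp k).symm hk,
    fun H => H.mono fun k hk => .head ((h.comp g).comp k) hk⟩

theorem reflTransGen_of_comp_classMap_eq {b b' : T ⟶ prodObj fun j => Pow (A j)}
    (h : b ≫ classMap A f = b' ≫ classMap A f) : Loc fun {W} (g : W ⟶ T) =>
      Relation.ReflTransGen (Step fun c => cond c (map₁ A f) (map₀ A s)) (g ≫ b) (g ≫ b') := by
  rw [← mem_classMap, h, mem_classMap]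
  exact .of_id .refl

theorem eq_of_comp_classMap_eq {X : C} {h : ∀ j, A j ⟶ X} (hf : ∀ i, f i ≫ h (t i) = h (s i))
    {j k : Fin n} {a : T ⟶ A j} {b : T ⟶ A k}
    (e : (a ≫ injHom A j) ≫ classMap A f = (b ≫ injHom A k) ≫ classMap A f) :
    a ≫ h j = b ≫ h k := by
  refine ((reflTransGen_of_comp_classMap_eq f e).eq fun {W} g hg => ?_)
  have : AllEq h (g ≫ b ≫ injHom A k) (g ≫ a ≫ h j) :=
    AllEq.of_reflTransGen f hf hg (by
      rw [← Category.assoc, ← Category.assoc]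
      exact AllEq.injHom h (g ≫ a))
  rw [← Category.assoc] at this
  rw [← this.eq_of_injHom, Category.assoc]

theorem coeqFullSub_factors_iff (w : T ⟶ Pow (prodObj fun j => Pow (A j))) :
    (coeqFullSub A f).Factors w ↔ Loc fun {W} (g : W ⟶ T) =>
      ∃ b : W ⟶ prodObj fun j => Pow (A j), g ≫ w = b ≫ classMap A f := by
  rw [coeqFullSub, coeqFm]
  refine (Fm.ex_factors (Γ := .snoc .nil _) _ w).trans ?_
  simp only [Fm.eq_factors, classTm_eval, Tm.env_wk, Tm.interp_var, env_zero,
    Var.zero_nil_interp]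
  exact ⟨fun h => h.mono fun _ ⟨b, e⟩ => ⟨b, (Category.comp_id _).symm.trans e⟩,
    fun h => h.mono fun _ ⟨b, e⟩ => ⟨b, (Category.comp_id _).trans e⟩⟩

theorem coeqSub_factors_iff (w : T ⟶ Pow (prodObj fun j => Pow (A j))) :
    (coeqSub A f).Factors w ↔ Loc fun {W} (g : W ⟶ T) =>
      ∃ b : W ⟶ prodObj fun j => Pow (A j),
        (coprodSub A).Factors b ∧ g ≫ w = b ≫ classMap A f := by
  rw [coeqSub, coeqOnFm]
  refine (Fm.ex_factors (Γ := .snoc .nil _) _ w).trans ?_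
  have hsub : ∀ {W : C} (v : W ⟶ Pow (prodObj fun j => Pow (A j)))
      (b : W ⟶ prodObj fun j => Pow (A j)) (σ : InternalLogic.Sub
        (.snoc .nil (prodObj fun j => Pow (A j)))
        ((Ctx.snoc .nil (Pow (prodObj fun j => Pow (A j)))).snoc (prodObj fun j => Pow (A j)))),
      σ _ .zero = .var .zero → (((coprodFm A (.var .zero)).subst σ).interp.Factors
        (env (Γ := .snoc .nil _) v b) ↔ (coprodSub A).Factors b) := by
    intro W v b σ hσ
    refine (Fm.subst_factors _ (u := (Var.zero (Γ := .snoc .nil _)).interp) ?_).trans ?_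
    · rintro _ (_ | ⟨⟨⟩⟩)
      rw [hσ, Var.zero_nil_interp]
      exact (Tm.interp_var _).trans (Category.comp_id _).symm
    · exact iff_of_eq (congrArg (coprodSub A).Factors (env_zero _ _))
  simp only [Fm.and_factors, Fm.eq_factors, classTm_eval, Tm.env_wk, Tm.interp_var, env_zero,
    Var.zero_nil_interp]
  exact ⟨fun h => h.mono fun _ ⟨b, hb, e⟩ =>
      ⟨b, (hsub _ b _ rfl).1 hb, (Category.comp_id _).symm.trans e⟩,
    fun h => h.mono fun _ ⟨b, hb, e⟩ =>
      ⟨b, (hsub _ b _ rfl).2 hb, (Category.comp_id _).trans e⟩⟩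

theorem coeqSub_le_coeqFullSub : coeqSub A f ≤ coeqFullSub A f :=
  Subobject.le_of_factors <| (coeqFullSub_factors_iff f _).2 <|
    ((coeqSub_factors_iff f _).1 (coeqSub A f).factors_self).mono fun _ ⟨b, _, e⟩ => ⟨b, e⟩

theorem coeqSub_factors_classMap :
    (coeqSub A f).Factors ((coprodSub A).arrow ≫ classMap A f) :=
  (coeqSub_factors_iff f _).2 (.of_id ⟨_, (coprodSub A).factors_self, Category.id_comp _⟩)

/-- The projection of the coproduct onto the object of equivalence classes. -/
def coeqπ : (coprodSub A : C) ⟶ (coeqSub A f : C) :=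
  (coeqSub A f).factorThru _ (coeqSub_factors_classMap f)

@[simp]
theorem coeqπ_arrow :
    coeqπ f ≫ (coeqSub A f).arrow = (coprodSub A).arrow ≫ classMap A f :=
  Subobject.factorThru_arrow _ _ _

theorem comp_coprodι_coeqπ_arrow {j : Fin n} (a : T ⟶ A j) :
    (a ≫ coprodι A j ≫ coeqπ f) ≫ (coeqSub A f).arrow = (a ≫ injHom A j) ≫ classMap A f := by
  simp only [Category.assoc, coeqπ_arrow]
  rw [← Category.assoc (coprodι A j), coprodι_arrow]

theorem coeqπ_cover : Loc fun {W} (g : W ⟶ (coeqSub A f : C)) =>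
    ∃ (j : Fin n) (a : W ⟶ A j), a ≫ coprodι A j ≫ coeqπ f = g := by
  refine ((coeqSub_factors_iff f _).1 (coeqSub A f).factors_self).bind ?_
  rintro W g ⟨b, hb, e⟩
  refine ((coprodSub_factors_iff A _).1 hb).mono ?_
  rintro V k ⟨j, a, e'⟩
  refine ⟨j, a, ?_⟩
  rw [← cancel_mono (coeqSub A f).arrow, comp_coprodι_coeqπ_arrow, ← e', Category.assoc,
    Category.assoc, e]

theorem existsUnique_coeqπ_desc {X : C} (h : ∀ j, A j ⟶ X)
    (hf : ∀ i, f i ≫ h (t i) = h (s i)) :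
    ∃! u : (coeqSub A f : C) ⟶ X, ∀ j, (coprodι A j ≫ coeqπ f) ≫ u = h j :=
  existsUnique_desc _ (coeqπ_cover f) h fun j k a b e => eq_of_comp_classMap_eq f hf (by
    rw [← comp_coprodι_coeqπ_arrow, e, comp_coprodι_coeqπ_arrow])

end Diagrams

end InternalLogic

end

theorem mainTheorem4 {C : Type u} [Category.{v} C] [CartesianMonoidalCategory C]
    [HasFiniteLimits C] [MonoidalClosed C] [HasSubobjectClassifier C] [HasCountableColimits C]
    {n m : ℕ} (A : Fin n → C) {s t : Fin m → Fin n} (f : ∀ i, A (s i) ⟶ A (t i)) :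
    ∃ (g₀ g₁ : (InternalLogic.coprodSub (fun i => A (s i)) : C) ⟶ (InternalLogic.coprodSub A : C))
      (q : (InternalLogic.coprodSub A : C) ⟶ (InternalLogic.coeqSub A f : C))
      (ι' : ∀ i, A (s i) ⟶ (InternalLogic.coprodSub (fun i => A (s i)) : C))
      (ι : ∀ j, A j ⟶ (InternalLogic.coprodSub A : C)),
      -- the diagram commutes
      g₀ ≫ (InternalLogic.coprodSub A).arrow =
          (InternalLogic.coprodSub (fun i => A (s i))).arrow ≫ InternalLogic.map₀ A s ∧
      g₁ ≫ (InternalLogic.coprodSub A).arrow =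
          (InternalLogic.coprodSub (fun i => A (s i))).arrow ≫ InternalLogic.map₁ A f ∧
      q ≫ (InternalLogic.coeqSub A f).arrow =
          (InternalLogic.coprodSub A).arrow ≫ InternalLogic.classMap A f ∧
      InternalLogic.coeqSub A f ≤ InternalLogic.coeqFullSub A f ∧
      -- the two objects on the left of the bottom row are coproducts
      (∀ i, ι' i ≫ (InternalLogic.coprodSub (fun i => A (s i))).arrow =
          InternalLogic.injHom (fun i => A (s i)) i) ∧
      (∀ j, ι j ≫ (InternalLogic.coprodSub A).arrow = InternalLogic.injHom A j) ∧
      Nonempty (IsColimit (Cofan.mk _ ι')) ∧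
      Nonempty (IsColimit (Cofan.mk _ ι)) ∧
      -- the parallel morphisms of the bottom row are those of the diagram
      (∀ i, ι' i ≫ g₀ = ι (s i)) ∧
      (∀ i, ι' i ≫ g₁ = f i ≫ ι (t i)) ∧
      -- the bottom row is a coequaliser, and so gives the colimit of the diagram
      (∃ w : g₀ ≫ q = g₁ ≫ q, Nonempty (IsColimit (Cofork.ofπ q w))) ∧
      InternalLogic.IsDiagramColimit A f (fun j => ι j ≫ q) := by
  have h₀ := InternalLogic.isImageMap_map₀ (A := A) (s := s)
  have h₁ := InternalLogic.isImageMap_map₁ f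
  have e₀ := (InternalLogic.coprodSub A).factorThru_arrow _ (h₀.factors)
  have e₁ := (InternalLogic.coprodSub A).factorThru_arrow _ (h₁.factors)
  generalize (InternalLogic.coprodSub A).factorThru _ (h₀.factors) = g₀ at e₀
  generalize (InternalLogic.coprodSub A).factorThru _ (h₁.factors) = g₁ at e₁
  have hg₀ : ∀ i, InternalLogic.coprodι (fun i => A (s i)) i ≫ g₀ = InternalLogic.coprodι A (s i) := fun i => by
    rw [← cancel_mono (InternalLogic.coprodSub A).arrow, Category.assoc, e₀, ← Category.assoc, InternalLogic.coprodι_arrow,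
      InternalLogic.coprodι_arrow, h₀.injHom_comp, Category.id_comp]
  have hg₁ : ∀ i, InternalLogic.coprodι (fun i => A (s i)) i ≫ g₁ = f i ≫ InternalLogic.coprodι A (t i) := fun i => by
    rw [← cancel_mono (InternalLogic.coprodSub A).arrow, Category.assoc, e₁, ← Category.assoc, InternalLogic.coprodι_arrow,
      Category.assoc, InternalLogic.coprodι_arrow, h₁.injHom_comp]
  have w : g₀ ≫ InternalLogic.coeqπ f = g₁ ≫ InternalLogic.coeqπ f := by
    rw [← cancel_mono (InternalLogic.coeqSub A f).arrow]
    simp only [Category.assoc, InternalLogic.coeqπ_arrow]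
    rw [← Category.assoc, ← Category.assoc, e₀, e₁]
    exact InternalLogic.comp_classMap_eq_of_step f ⟨false, _, rfl, rfl⟩
  have hκ : ∀ i, f i ≫ InternalLogic.coprodι A (t i) ≫ InternalLogic.coeqπ f = InternalLogic.coprodι A (s i) ≫ InternalLogic.coeqπ f := fun i => by
    rw [← Category.assoc, ← hg₁, ← hg₀, Category.assoc, Category.assoc, w]
  refine ⟨g₀, g₁, InternalLogic.coeqπ f, InternalLogic.coprodι _, InternalLogic.coprodι A, e₀, e₁, InternalLogic.coeqπ_arrow f,
    InternalLogic.coeqSub_le_coeqFullSub f, InternalLogic.coprodι_arrow _, InternalLogic.coprodι_arrow A, InternalLogic.isColimit_coprodι,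
    InternalLogic.isColimit_coprodι, hg₀, hg₁, ⟨w, ⟨Cofork.IsColimit.ofExistsUnique fun c => ?_⟩⟩, hκ,
    fun X h hf => InternalLogic.existsUnique_coeqπ_desc f h hf⟩
  obtain ⟨u, hu, hu'⟩ := InternalLogic.existsUnique_coeqπ_desc f (fun j => InternalLogic.coprodι A j ≫ c.π) fun i => by
    rw [← Category.assoc, ← hg₁, ← hg₀, Category.assoc, Category.assoc, c.condition]
  refine ⟨u, InternalLogic.coprodSub_hom_ext A fun j => ?_, fun v hv => hu' v fun j => ?_⟩
  · exact (Category.assoc _ _ _).symm.trans (hu j)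
  · exact (Category.assoc _ _ _).trans (congrArg (InternalLogic.coprodι A j ≫ ·) hv)
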